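/- Let $\mathcal M$ be a $C^*$-algebra (respectively a $W^*$-algebra) and let $X=(X(n))_{n\in\mathbb Z_+}$ be a subproduct system of $C^*$-correspondences (respectively $W^*$-correspondences) over $\mathcal M$: $X(0)=\mathcal M$, the left actions are nondegenerate, and there are coisometric adjointable bimodule maps $U_{n,m}:X(n)\otimes X(m)\to X(n+m)$ such that $U_{n,0}(\zeta\otimes a)=\zeta a$, $U_{0,n}(a\otimes\zeta)=a\zeta$ and $U_{n+m,l}(U_{n,m}\otimes I)=U_{n,m+l}(I\otimes U_{m,l})$. In particular, $X$ may be a standard subproduct system, in which $X(n+m)$ is an orthogonally complemented sub-bimodule of $X(n)\otimes X(m)$ and $U_{n,m}$ is the orthogonal projection onto it. Let $\mathcal F_X=\bigoplus_n X(n)$ be the Fock space, with the operators $S_n(\zeta)\eta=U_{n,m}(\zeta\otimes\eta)$ for $\zeta\in X(n)$, $\eta\in X(m)$. Representations of $\mathcal M$ are nondegenerate $*$-representations on Hilbert spaces, normal in the $W^*$-case. Let $T=(T_n)_{n\in\mathbb Z_+}$ be a completely contractive covariant representation of $X$ on a Hilbert space $\mathcal H$: $\sigma:=T_0$ is a representation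 of $\mathcal M$, each $T_n:X(n)\to B(\mathcal H)$ is linear and completely contractive, $T_n(a\zeta b)=\sigma(a)T_n(\zeta)\sigma(b)$ for $a,b\in\mathcal M$, and $T_{n+m}(U_{n,m}(\zeta\otimes\eta))=T_n(\zeta)T_m(\eta)$. Let $\widetilde T_n:X(n)\otimes_\sigma\mathcal H\to\mathcal H$ be the contraction $\zeta\otimes h\mapsto T_n(\zeta)h$, and assume that $T$ is pure: $\widetilde T_n\widetilde T_n^*\to 0$ in the strong operator topology. Let $\mathcal S\neq\{0\}$ be a closed subspace of $\mathcal H$. Then $\mathcal S$ is invariant for $T$ (that is, invariant for $\sigma(\mathcal M)$ and for all $T_n(\zeta)$, $\zeta\in X(n)$, $n\ge 1$) if and only if there exist a Hilbert space $\mathcal D$, a representation $\pi$ of $\mathcal M$ on $\mathcal D$, and a partial isometry $\Pi:\mathcal F_X\otimes_\pi\mathcal D\to\mathcal H$ such that $\mathcal S=\operatorname{ran}\Pi$ and $$\Pi\,(S_n(\zeta)\otimes I_{\mathcal D})=T_n(\zeta)\,\Pi\qquad(\zeta\in X(n),\ n\in\mathbb Z_+).$$ -/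

import Mathlib

set_option linter.unusedSectionVars false

universe u v w

open scoped InnerProductSpace TensorProduct

/-! ## Right inner product modules over a C⋆-algebra -/

/-- A right inner product module `E` over the C⋆-algebra `M`: `E` carries a right action of `M`
(written as an action of `Mᵐᵒᵖ`, so that `MulOpposite.op a • x` is `x a`) and an `M`-valued inner
product which is definite, and linear over `ℂ` and over `M` in the second variable.  No completeness
is required here. The module axioms for the right action (additivity, associativity) follow from
the definiteness of the inner product. -/
class RightInnerModule (M : Type u) (E : Type v) [NonUnitalCStarAlgebra M] [PartialOrder M]
    [AddCommGroup E] [Module ℂ E] [SMul Mᵐᵒᵖ E] extends Inner M E where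
  inner_add_right : ∀ x y z : E, inner x (y + z) = inner x y + inner x z
  inner_smul_right : ∀ (c : ℂ) (x y : E), inner x (c • y) = c • inner x y
  inner_op_smul_right : ∀ (x y : E) (a : M), inner x (MulOpposite.op a • y) = inner x y * a
  star_inner : ∀ x y : E, star (inner x y) = inner y x
  inner_self_nonneg : ∀ x : E, 0 ≤ inner x x
  inner_self_eq_zero : ∀ x : E, inner x x = 0 → x = 0

namespace RightInnerModule

variable {M : Type u} {E : Type v} [NonUnitalCStarAlgebra M] [PartialOrder M]
  [AddCommGroup E] [Module ℂ E] [SMul Mᵐᵒᵖ E] [RightInnerModule M E]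

theorem inner_add_left (x y z : E) : inner M (x + y) z = inner M x z + inner M y z := by
  rw [← star_inner, inner_add_right, star_add, star_inner, star_inner]

theorem inner_smul_left (c : ℂ) (x y : E) : inner M (c • x) y = star c • inner M x y := by
  rw [← star_inner, inner_smul_right, star_smul, star_inner]

theorem inner_op_smul_left (x y : E) (a : M) :
    inner M (MulOpposite.op a • x) y = star a * inner M x y := by
  rw [← star_inner, inner_op_smul_right, star_mul, star_inner]

theorem inner_sum_right {ι : Type*} (s : Finset ι) (x : E) (y : ι → E) :
    inner M x (∑ i ∈ s, y i) = ∑ i ∈ s, inner M x (y i) :=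
  map_sum (AddMonoidHom.mk' (fun y => inner M x y) (fun y z => inner_add_right x y z)) y s

theorem inner_sum_left {ι : Type*} (s : Finset ι) (x : E) (y : ι → E) :
    inner M (∑ i ∈ s, y i) x = ∑ i ∈ s, inner M (y i) x :=
  map_sum (AddMonoidHom.mk' (fun y => inner M y x) (fun y z => inner_add_left y z x)) y s

/-- The Gram matrix `(⟨x i, x j⟩)` of a family of vectors, a matrix over `M`. -/
def gram {n : Type*} (x : n → E) : CStarMatrix n n M :=
  CStarMatrix.ofMatrix (Matrix.of fun i j => inner M (x i) (x j))

section Generic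

variable {A : Type*} [NonUnitalCStarAlgebra A] [PartialOrder A] [StarOrderedRing A]

theorem exists_star_mul_self {a : A} (ha : 0 ≤ a) : ∃ b : A, a = star b * b :=
  CStarAlgebra.nonneg_iff_eq_star_mul_self.mp ha

theorem eq_zero_of_cube {m : A} (hm : IsSelfAdjoint m) (h : m * m * m = 0) : m = 0 := by
  have h3 : star (m * m) * (m * m) = 0 := by
    rw [star_mul, hm.star_eq, ← mul_assoc, h, zero_mul]
  have h4 := (CStarRing.star_mul_self_eq_zero_iff _).mp h3
  have h5 : star m * m = 0 := by rw [hm.star_eq, h4]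
  exact (CStarRing.star_mul_self_eq_zero_iff _).mp h5

theorem exists_pos_sub_neg {a : A} (ha : IsSelfAdjoint a) :
    ∃ p m : A, 0 ≤ p ∧ 0 ≤ m ∧ IsSelfAdjoint m ∧ m * p = 0 ∧ a = p - m :=
  ⟨a⁺, a⁻, CFC.posPart_nonneg a, CFC.negPart_nonneg a, (CFC.negPart_nonneg a).isSelfAdjoint,
    CFC.negPart_mul_posPart a, (CFC.posPart_sub_negPart a ha).symm⟩

theorem cube_nonneg {m : A} (hm : 0 ≤ m) : 0 ≤ m * m * m := by
  have := star_left_conjugate_nonneg hm m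
  rwa [hm.isSelfAdjoint.star_eq] at this

end Generic

variable [StarOrderedRing M]

theorem eq_zero_of_diag {n : Type*} [Fintype n] (Y : CStarMatrix n n M) (hY : 0 ≤ Y)
    (hd : ∀ i, Y i i ≤ 0) : Y = 0 := by
  obtain ⟨Z, rfl⟩ := exists_star_mul_self hY
  have hZ : Z = 0 := by
    ext k i
    have h1 : ∑ k, star (Z k i) * Z k i ≤ 0 := by
      have := hd i
      rwa [CStarMatrix.mul_apply] at this
    have h2 := (Finset.sum_eq_zero_iff_of_nonneg
      (fun k _ => star_mul_self_nonneg (Z k i))).mp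
      (le_antisymm h1 (Finset.sum_nonneg fun k _ => star_mul_self_nonneg (Z k i))) k
      (Finset.mem_univ _)
    simpa using CStarRing.star_mul_self_eq_zero_iff _ |>.mp h2
  rw [hZ, mul_zero]

/-- Gram matrices are positive in the C⋆-algebra of matrices over `M`. -/
theorem gram_nonneg {n : Type*} [Fintype n] (x : n → E) : 0 ≤ gram (M := M) x := by
  have hsa : IsSelfAdjoint (gram (M := M) x) := by
    ext i j
    simp [gram, star_inner, CStarMatrix.star_apply]
  have key : ∀ (b : CStarMatrix n n M) (i : n), 0 ≤ (star b * gram (M := M) x * b) i i := by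
    intro b i
    have : (star b * gram (M := M) x * b) i i
        = inner M (∑ j, MulOpposite.op (b j i) • x j) (∑ j, MulOpposite.op (b j i) • x j) := by
      simp only [inner_sum_left, inner_sum_right, inner_op_smul_left, inner_op_smul_right,
        CStarMatrix.mul_apply, Finset.sum_mul]
      rw [Finset.sum_comm]
      simp only [gram, mul_assoc]
      rw [Finset.sum_comm]
      rfl
    rw [this]
    exact inner_self_nonneg _
  obtain ⟨p, m, hp, hm, hsm, hmp, hdec⟩ := exists_pos_sub_neg hsa
  have hm0 : m = 0 := by
    refine eq_zero_of_cube hsm (eq_zero_of_diag _ (cube_nonneg hm) fun i => ?_)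
    have h1 : star m * gram (M := M) x * m = - (m * m * m) := by
      rw [hdec, mul_sub, sub_mul, hsm.star_eq, hmp, zero_mul, zero_sub]
    have h2 := key m i
    rw [h1] at h2
    exact neg_nonneg.mp h2
  rw [hdec, hm0, sub_zero]
  exact hp

theorem exists_gram_eq {n : Type*} [Fintype n] (x : n → E) :
    ∃ Z : n → n → M, ∀ i j, inner M (x i) (x j) = ∑ k, star (Z k i) * Z k j := by
  obtain ⟨Z, hZ⟩ := exists_star_mul_self (gram_nonneg (M := M) x)
  refine ⟨fun i j => Z i j, fun i j => ?_⟩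
  have := congrArg (fun A : CStarMatrix n n M => A i j) hZ
  rw [CStarMatrix.mul_apply] at this
  exact this

end RightInnerModule

/-! ## The Hilbert space `E ⊗_π H` -/

section ITensor

variable {M : Type u} [NonUnitalCStarAlgebra M] [PartialOrder M] [StarOrderedRing M]
  {E : Type v} [AddCommGroup E] [Module ℂ E] [SMul Mᵐᵒᵖ E] [RightInnerModule M E]
  {H : Type w} [NormedAddCommGroup H] [InnerProductSpace ℂ H] [CompleteSpace H]

variable (E) in
/-- The sesquilinear form on the algebraic tensor product `E ⊗ H` determined by
`(ζ ⊗ h, η ⊗ k) ↦ ⟪h, π(⟨ζ, η⟩) k⟫`. -/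
noncomputable def interiorForm (π : M →⋆ₙₐ[ℂ] (H →L[ℂ] H)) :
    (E ⊗[ℂ] H) →ₗ⋆[ℂ] (E ⊗[ℂ] H) →ₗ[ℂ] ℂ :=
  TensorProduct.lift <| LinearMap.mk₂'ₛₗ (starRingEnd ℂ) (starRingEnd ℂ)
    (fun (ζ : E) (h : H) => TensorProduct.lift <| LinearMap.mk₂ ℂ
      (fun (η : E) (k : H) => ⟪h, π (inner M ζ η) k⟫_ℂ)
      (fun _ _ _ => by simp [RightInnerModule.inner_add_right])
      (fun _ _ _ => by simp [RightInnerModule.inner_smul_right])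
      (fun _ _ _ => by simp)
      (fun _ _ _ => by simp))
    (fun _ _ _ => by ext; simp [RightInnerModule.inner_add_left])
    (fun _ _ _ => by ext; simp [RightInnerModule.inner_smul_left])
    (fun _ _ _ => by ext; simp)
    (fun _ _ _ => by ext; simp [mul_comm])

theorem interiorForm_tmul (π : M →⋆ₙₐ[ℂ] (H →L[ℂ] H)) (ζ η : E) (h k : H) :
    interiorForm E π (ζ ⊗ₜ h) (η ⊗ₜ k) = ⟪h, π (inner M ζ η) k⟫_ℂ := rfl

theorem interiorForm_sum (π : M →⋆ₙₐ[ℂ] (H →L[ℂ] H)) {ι : Type*} [Fintype ι] (ζ : ι → E)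
    (h : ι → H) :
    interiorForm E π (∑ i, ζ i ⊗ₜ h i) (∑ j, ζ j ⊗ₜ h j)
      = ∑ i, ∑ j, ⟪h i, π (inner M (ζ i) (ζ j)) (h j)⟫_ℂ := by
  simp only [map_sum, LinearMap.sum_apply, interiorForm_tmul]
  exact Finset.sum_comm

theorem sum_inner_of_factor (π : M →⋆ₙₐ[ℂ] (H →L[ℂ] H)) {ι κ : Type*} [Fintype ι] [Fintype κ]
    (g : ι → ι → M) (Z : κ → ι → M) (hZ : ∀ i j, g i j = ∑ k, star (Z k i) * Z k j)
    (h : ι → H) :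
    ∑ i, ∑ j, ⟪h i, π (g i j) (h j)⟫_ℂ = ((∑ k, ‖∑ j, π (Z k j) (h j)‖ ^ 2 : ℝ) : ℂ) := by
  have h1 : ∀ i j, ⟪h i, π (g i j) (h j)⟫_ℂ
      = ∑ k, ⟪π (Z k i) (h i), π (Z k j) (h j)⟫_ℂ := by
    intro i j
    simp only [hZ, map_sum, map_mul, map_star, sum_apply, inner_sum]
    refine Finset.sum_congr rfl fun k _ => ?_
    rw [ContinuousLinearMap.star_eq_adjoint, mul_apply_eq_comp,
      ContinuousLinearMap.adjoint_inner_right]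
  simp only [h1]
  push_cast
  rw [Finset.sum_congr rfl fun i _ => Finset.sum_comm, Finset.sum_comm]
  refine Finset.sum_congr rfl fun k _ => ?_
  have := inner_self_eq_norm_sq_to_K (𝕜 := ℂ) (∑ j, π (Z k j) (h j))
  rw [sum_inner] at this
  simp only [inner_sum] at this
  exact_mod_cast this

theorem interiorForm_self_nonneg (π : M →⋆ₙₐ[ℂ] (H →L[ℂ] H)) (z : E ⊗[ℂ] H) :
    0 ≤ (interiorForm E π z z).re := by
  obtain ⟨k, ζ, h, rfl⟩ := TensorProduct.exists_sum_tmul_eq z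
  obtain ⟨Z, hZ⟩ := RightInnerModule.exists_gram_eq (M := M) ζ
  rw [interiorForm_sum, sum_inner_of_factor π _ Z hZ, Complex.ofReal_re]
  positivity

theorem interiorForm_conj (π : M →⋆ₙₐ[ℂ] (H →L[ℂ] H)) (x y : E ⊗[ℂ] H) :
    starRingEnd ℂ (interiorForm E π y x) = interiorForm E π x y := by
  induction x with
  | zero => simp
  | add a b ha hb => simp [ha, hb]
  | tmul ζ h =>
    induction y with
    | zero => simp
    | add a b ha hb => simp only [map_add, LinearMap.add_apply, ha, hb]
    | tmul η k =>
      rw [interiorForm_tmul, interiorForm_tmul, inner_conj_symm, ← RightInnerModule.star_inner η ζ, map_star,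
        ContinuousLinearMap.star_eq_adjoint, ContinuousLinearMap.adjoint_inner_right]

variable (E) in
/-- The form of `E ⊗_π H` is a positive semidefinite inner product. -/
@[reducible] noncomputable def interiorCore (π : M →⋆ₙₐ[ℂ] (H →L[ℂ] H)) :
    PreInnerProductSpace.Core ℂ (E ⊗[ℂ] H) where
  inner x y := interiorForm E π x y
  conj_inner_symm x y := interiorForm_conj π x y
  re_inner_nonneg x := interiorForm_self_nonneg π x
  add_left x y z := by rw [map_add]; rfl
  smul_left x y c := by rw [map_smulₛₗ]; rfl

variable (E) in
/-- The algebraic tensor product `E ⊗ H` with the semi-inner product defined by `π`. -/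
def InteriorPre (_π : M →⋆ₙₐ[ℂ] (H →L[ℂ] H)) : Type (max v w) := E ⊗[ℂ] H

namespace InteriorPre

variable (π : M →⋆ₙₐ[ℂ] (H →L[ℂ] H))

noncomputable instance : SeminormedAddCommGroup (InteriorPre E π) :=
  @InnerProductSpace.Core.toSeminormedAddCommGroup ℂ (E ⊗[ℂ] H) _ _ _ (interiorCore E π)

noncomputable instance : InnerProductSpace ℂ (InteriorPre E π) :=
  InnerProductSpace.ofCore (interiorCore E π)

variable (E) in
/-- The identity map from the algebraic tensor product to `InteriorPre E π`. -/
noncomputable def of : (E ⊗[ℂ] H) →ₗ[ℂ] InteriorPre E π where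
  toFun z := z
  map_add' _ _ := rfl
  map_smul' _ _ := rfl

theorem inner_of (x y : E ⊗[ℂ] H) : ⟪of E π x, of E π y⟫_ℂ = interiorForm E π x y := rfl

theorem of_surjective : Function.Surjective (of E π) := fun z => ⟨z, rfl⟩

end InteriorPre

variable (E) in
/-- The Hilbert space `E ⊗_π H`: the Hausdorff completion of the algebraic tensor product in the
semi-inner product `⟪ζ ⊗ h, η ⊗ k⟫ = ⟪h, π(⟨ζ, η⟩) k⟫`. -/
abbrev InteriorTensor (π : M →⋆ₙₐ[ℂ] (H →L[ℂ] H)) : Type (max v w) :=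
  UniformSpace.Completion (InteriorPre E π)

namespace InteriorTensor

variable (π : M →⋆ₙₐ[ℂ] (H →L[ℂ] H))

variable (E) in
/-- The canonical map from the algebraic tensor product to `E ⊗_π H`. -/
noncomputable def incl : (E ⊗[ℂ] H) →ₗ[ℂ] InteriorTensor E π :=
  (UniformSpace.Completion.toComplₗᵢ (𝕜 := ℂ) (E := InteriorPre E π)).toLinearMap ∘ₗ
    InteriorPre.of E π

/-- The elementary tensor `ζ ⊗ h` in `E ⊗_π H`. -/
noncomputable def tmul (ζ : E) (h : H) : InteriorTensor E π := incl E π (ζ ⊗ₜ[ℂ] h)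

theorem inner_incl (x y : E ⊗[ℂ] H) : ⟪incl E π x, incl E π y⟫_ℂ = interiorForm E π x y :=
  UniformSpace.Completion.inner_coe _ _

theorem inner_tmul (ζ η : E) (h k : H) :
    ⟪tmul π ζ h, tmul π η k⟫_ℂ = ⟪h, π (inner M ζ η) k⟫_ℂ := inner_incl π _ _

theorem norm_incl_sq (x : E ⊗[ℂ] H) : ‖incl E π x‖ ^ 2 = (interiorForm E π x x).re := by
  rw [← inner_incl, ← inner_self_eq_norm_sq (𝕜 := ℂ)]; rfl

theorem denseRange_incl : DenseRange (incl E π) :=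
  UniformSpace.Completion.denseRange_coe.comp (InteriorPre.of_surjective π).denseRange
    (UniformSpace.Completion.continuous_coe _)

variable {K : Type*} [NormedAddCommGroup K] [InnerProductSpace ℂ K] [CompleteSpace K]

/-- The bounded operator on `E ⊗_π H` given on elementary tensors by `ζ ⊗ h ↦ f ζ h`, for a bilinear
map `f` that is bounded for the norm of `E ⊗_π H` (see `lift_tmul`). -/
noncomputable def lift (f : E →ₗ[ℂ] H →ₗ[ℂ] K) : InteriorTensor E π →L[ℂ] K :=
  (TensorProduct.lift f).extendOfNorm (incl E π)

theorem lift_tmul (f : E →ₗ[ℂ] H →ₗ[ℂ] K)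
    (hf : ∃ C : ℝ, ∀ z, ‖TensorProduct.lift f z‖ ≤ C * ‖incl E π z‖) (ζ : E) (h : H) :
    lift π f (tmul π ζ h) = f ζ h :=
  LinearMap.extendOfNorm_eq (denseRange_incl π) hf _

theorem gram_form_nonneg {ι : Type*} [Fintype ι] (ζ : ι → E) (h : ι → H) :
    0 ≤ (∑ i, ∑ j, ⟪h i, π (inner M (ζ i) (ζ j)) (h j)⟫_ℂ).re := by
  rw [← interiorForm_sum]
  exact interiorForm_self_nonneg π _

end InteriorTensor

section Contractive

variable {σ : M →⋆ₙₐ[ℂ] (H →L[ℂ] H)} {T : E →ₗ[ℂ] (H →L[ℂ] H)}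

/-- Complete contractivity of a linear map `T : E → B(H)`: for every matrix `ξ ∈ M_n(E)` the operator
`[T (ξ i j)]` on `Hⁿ` has norm at most the norm of `ξ` in `M_n(E)`, whose square is the norm of the
matrix `(∑ l, ⟨ξ l i, ξ l j⟩)` in the C⋆-algebra `M_n(M)`. -/
def IsCompletelyContractive (M : Type u) [NonUnitalCStarAlgebra M] [PartialOrder M]
    [StarOrderedRing M]
    {E : Type v} [AddCommGroup E] [Module ℂ E] [SMul Mᵐᵒᵖ E] [RightInnerModule M E]
    {H : Type w} [NormedAddCommGroup H] [InnerProductSpace ℂ H]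
    (T : E →ₗ[ℂ] (H →L[ℂ] H)) : Prop :=
  ∀ (n : ℕ) (ξ : Fin n → Fin n → E) (h : Fin n → H),
    ∑ i, ‖∑ j, T (ξ i j) (h j)‖ ^ 2
      ≤ ‖∑ l, RightInnerModule.gram (M := M) (ξ l)‖ * ∑ j, ‖h j‖ ^ 2

theorem IsCompletelyContractive.row (hT : IsCompletelyContractive M T) {n : ℕ} (ξ : Fin n → E)
    (h : Fin n → H) :
    ‖∑ j, T (ξ j) (h j)‖ ^ 2 ≤ ‖RightInnerModule.gram (M := M) ξ‖ * ∑ j, ‖h j‖ ^ 2 := by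
  rcases n with _ | n
  · simp
  have h1 := hT (n + 1) (fun i j => if i = 0 then ξ j else 0) h
  have h2 : ∑ l : Fin (n + 1), RightInnerModule.gram (M := M)
      (fun j => if l = 0 then ξ j else 0) = RightInnerModule.gram (M := M) ξ := by
    rw [Finset.sum_eq_single 0]
    · simp
    · intro b _ hb
      ext i j
      have := RightInnerModule.inner_smul_right (M := M) (0 : ℂ) (0 : E) (0 : E)
      simpa [RightInnerModule.gram, hb] using this
    · simp
  rw [h2] at h1
  refine le_trans ?_ h1
  refine le_trans (le_of_eq ?_) (Finset.single_le_sum (fun i _ => by positivity)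
    (Finset.mem_univ (0 : Fin (n + 1))))
  simp

theorem exists_regularization {A : Type*} [NonUnitalCStarAlgebra A] [PartialOrder A]
    [StarOrderedRing A] {G : A} (hG : 0 ≤ G) {ε : ℝ} (hε : 0 < ε) :
    ∃ g s : A, star g = g ∧ star s = s ∧ s * s = G ∧ ‖g * G * g‖ ≤ 1 ∧ star (g * s) = g * s ∧
      ‖G - G * (g * s) - (g * s) * G + (g * s) * G * (g * s)‖ ≤ ε := by
  have hsa : IsSelfAdjoint G := hG.isSelfAdjoint
  have hq : ∀ t ∈ quasispectrum ℝ G, 0 ≤ t := fun t ht => quasispectrum_nonneg_of_nonneg G hG t ht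
  let fg : ℝ → ℝ := fun t => √t / (t + ε)
  let fs : ℝ → ℝ := fun t => √t
  have cg : ContinuousOn fg (quasispectrum ℝ G) := by
    apply ContinuousOn.div (by fun_prop) (by fun_prop)
    intro t ht
    have := hq t ht
    positivity
  have cs : ContinuousOn fs (quasispectrum ℝ G) := by fun_prop
  have g0 : fg 0 = 0 := by simp [fg]
  have s0 : fs 0 = 0 := by simp [fs]
  have i0 : (fun t : ℝ => t) 0 = 0 := rfl
  have ci : ContinuousOn (fun t : ℝ => t) (quasispectrum ℝ G) := continuousOn_id
  have hid : cfcₙ (fun t : ℝ => t) G = G := cfcₙ_id' ℝ G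
  have hmul : ∀ f f' : ℝ → ℝ, ContinuousOn f (quasispectrum ℝ G) → f 0 = 0 →
      ContinuousOn f' (quasispectrum ℝ G) → f' 0 = 0 →
      cfcₙ f G * cfcₙ f' G = cfcₙ (fun t => f t * f' t) G :=
    fun f f' hf h0 hf' h0' => (cfcₙ_mul f f' G hf h0 hf' h0').symm
  have hl : ∀ f : ℝ → ℝ, ContinuousOn f (quasispectrum ℝ G) → f 0 = 0 →
      G * cfcₙ f G = cfcₙ (fun t => t * f t) G := fun f hf h0 => by
    have := hmul _ f ci i0 hf h0
    rwa [hid] at this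
  have hr : ∀ f : ℝ → ℝ, ContinuousOn f (quasispectrum ℝ G) → f 0 = 0 →
      cfcₙ f G * G = cfcₙ (fun t => f t * t) G := fun f hf h0 => by
    have := hmul f _ hf h0 ci i0
    rwa [hid] at this
  have hβ : ∀ t ∈ quasispectrum ℝ G, fg t * fs t = t / (t + ε) := by
    intro t ht
    have := Real.mul_self_sqrt (hq t ht)
    have h2 : 0 < t + ε := by linarith [hq t ht]
    simp only [fg, fs]
    field_simp
    nlinarith
  refine ⟨cfcₙ fg G, cfcₙ fs G, (IsSelfAdjoint.cfcₙ).star_eq, (IsSelfAdjoint.cfcₙ).star_eq,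
    ?_, ?_, ?_, ?_⟩
  · rw [hmul fs fs cs s0 cs s0]
    refine Eq.trans (cfcₙ_congr fun t ht => ?_) hid
    exact Real.mul_self_sqrt (hq t ht)
  · have : cfcₙ fg G * G * cfcₙ fg G = cfcₙ (fun t => fg t * t * fg t) G := by
      rw [hr fg cg g0]
      exact hmul _ _ (cg.mul ci) (by simp [g0]) cg g0
    rw [this]
    refine norm_cfcₙ_le fun t ht => ?_
    have ht0 := hq t ht
    have h1 : fg t * t * fg t = (t / (t + ε)) ^ 2 := by
      rw [← hβ t ht]
      have := Real.mul_self_sqrt ht0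
      simp only [fg, fs]
      calc _ = (√t / (t + ε)) ^ 2 * t := by ring
        _ = (√t / (t + ε)) ^ 2 * (√t * √t) := by rw [this]
        _ = _ := by ring
    rw [h1, Real.norm_eq_abs, abs_of_nonneg (by positivity)]
    refine pow_le_one₀ (by positivity) ?_
    rw [div_le_one (by positivity)]
    linarith
  · rw [hmul fg fs cg g0 cs s0]
    exact (IsSelfAdjoint.cfcₙ).star_eq
  · rw [hmul fg fs cg g0 cs s0]
    have cb : ContinuousOn (fun t => fg t * fs t) (quasispectrum ℝ G) := cg.mul cs
    have b0 : (fun t => fg t * fs t) 0 = 0 := by simp [g0]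
    have hβ' : ∀ t ∈ quasispectrum ℝ G, (fun t => fg t * fs t) t = t / (t + ε) := hβ
    generalize (fun t => fg t * fs t) = b at cb b0 hβ' ⊢
    have c1 : ContinuousOn (fun t => t * b t) (quasispectrum ℝ G) := ci.mul cb
    have c2 : ContinuousOn (fun t => b t * t) (quasispectrum ℝ G) := cb.mul ci
    have c3 : ContinuousOn (fun t => b t * t * b t) (quasispectrum ℝ G) := c2.mul cb
    have e : G - G * cfcₙ b G - cfcₙ b G * G + cfcₙ b G * G * cfcₙ b G
        = cfcₙ (fun t => t - t * b t - b t * t + b t * t * b t) G := by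
      rw [hl b cb b0, hr b cb b0, hmul _ b c2 (by simp) cb b0,
        cfcₙ_add (fun t => t - t * b t - b t * t) (fun t => b t * t * b t) G
          ((ci.sub c1).sub c2) (by simp) c3 (by simp),
        cfcₙ_sub (fun t => t - t * b t) (fun t => b t * t) G
          (ci.sub c1) (by simp) c2 (by simp),
        cfcₙ_sub (fun t => t) (fun t => t * b t) G ci i0 c1 (by simp), hid]
    rw [e]
    refine norm_cfcₙ_le fun t ht => ?_
    have ht0 := hq t ht
    have h2 : 0 < t + ε := by linarith
    have h3 : t - t * b t - b t * t + b t * t * b t = t * (ε / (t + ε)) ^ 2 := by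
      rw [hβ' t ht]
      field_simp
      ring
    rw [h3, Real.norm_eq_abs, abs_of_nonneg (by positivity), div_pow, mul_div_assoc',
      div_le_iff₀ (by positivity)]
    nlinarith [mul_nonneg ht0 hε.le, mul_nonneg (mul_nonneg ht0 ht0) hε.le,
      mul_nonneg (mul_nonneg ht0 hε.le) hε.le, pow_pos hε 3]

/-- The estimate showing that `ξ ⊗ h ↦ T ξ h` is contractive on `E ⊗_σ H`. -/
theorem IsCompletelyContractive.norm_sum_sq_le (hT : IsCompletelyContractive M T)
    (hcov : ∀ (ξ : E) (a : M), T (MulOpposite.op a • ξ) = T ξ * σ a)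
    {n : ℕ} (ξ : Fin n → E) (h : Fin n → H) :
    ‖∑ j, T (ξ j) (h j)‖ ^ 2
      ≤ (∑ i, ∑ j, ⟪h i, σ (inner M (ξ i) (ξ j)) (h j)⟫_ℂ).re := by
  set G := RightInnerModule.gram (M := M) ξ with hGdef
  have hG : 0 ≤ G := RightInnerModule.gram_nonneg ξ
  have hmulgram : ∀ b : CStarMatrix (Fin n) (Fin n) M, RightInnerModule.gram (M := M)
      (fun j => ∑ i, MulOpposite.op (b i j) • ξ i) = star b * G * b := by
    intro b
    ext i j
    simp only [RightInnerModule.gram, CStarMatrix.ofMatrix_apply, Matrix.of_apply,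
      RightInnerModule.inner_sum_left, RightInnerModule.inner_sum_right,
      RightInnerModule.inner_op_smul_left, RightInnerModule.inner_op_smul_right,
      CStarMatrix.mul_apply, Finset.sum_mul, hGdef]
    rw [Finset.sum_comm]
    simp only [mul_assoc]
    rw [Finset.sum_comm]
    rfl
  have hTb : ∀ (b : CStarMatrix (Fin n) (Fin n) M) (k : Fin n → H),
      ∑ j, T (∑ i, MulOpposite.op (b i j) • ξ i) (k j)
        = ∑ i, T (ξ i) (∑ j, σ (b i j) (k j)) := by
    intro b k
    simp only [map_sum, hcov, sum_apply, mul_apply_eq_comp]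
    exact Finset.sum_comm
  have hgramsub : ∀ b : CStarMatrix (Fin n) (Fin n) M, star b = b → RightInnerModule.gram (M := M)
      (fun j => ξ j - ∑ i, MulOpposite.op (b i j) • ξ i) = G - G * b - b * G + b * G * b := by
    intro b hb
    have hs : ∀ i j, star (b i j) = b j i := fun i j => congrFun (congrFun hb j) i
    have h1 := hmulgram b
    rw [hb] at h1
    rw [← h1]
    ext i j
    have hneg : ∀ x y : E, inner M x (-y) = - inner M x y := fun x y => by
      have := RightInnerModule.inner_smul_right (M := M) (-1 : ℂ) x y
      simpa using this
    have hneg' : ∀ x y : E, inner M (-x) y = - inner M x y := fun x y => by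
      have := RightInnerModule.inner_smul_left (M := M) (-1 : ℂ) x y
      simpa using this
    have hexp : ∀ x y z w : E, inner M (x - y) (z - w)
        = inner M x z - inner M x w - inner M y z + inner M y w := fun x y z w => by
      simp only [sub_eq_add_neg, RightInnerModule.inner_add_left,
        RightInnerModule.inner_add_right, hneg, hneg']
      abel
    simp only [CStarMatrix.add_apply, CStarMatrix.sub_apply, CStarMatrix.mul_apply, hGdef,
      RightInnerModule.gram, CStarMatrix.ofMatrix_apply, Matrix.of_apply, hexp]
    have h2 : inner M (ξ i) (∑ k, MulOpposite.op (b k j) • ξ k)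
        = ∑ k, inner M (ξ i) (ξ k) * b k j := by
      simp only [RightInnerModule.inner_sum_right, RightInnerModule.inner_op_smul_right]
    have h3 : inner M (∑ k, MulOpposite.op (b k i) • ξ k) (ξ j)
        = ∑ k, b i k * inner M (ξ k) (ξ j) := by
      simp only [RightInnerModule.inner_sum_left, RightInnerModule.inner_op_smul_left, hs]
    rw [h2, h3]
  have main : ∀ ε : ℝ, 0 < ε → ‖∑ j, T (ξ j) (h j)‖ ≤ √ε * √(∑ j, ‖h j‖ ^ 2)
      + √(∑ i, ∑ j, ⟪h i, σ (inner M (ξ i) (ξ j)) (h j)⟫_ℂ).re := by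
    intro ε hε
    obtain ⟨g, s, hg, hs, hss, hgG, hb, hsub⟩ := exists_regularization hG hε
    have hfac : ∀ i j, inner M (ξ i) (ξ j) = ∑ k, star (s k i) * s k j := by
      intro i j
      have h1 : star s * s = G := by rw [hs, hss]
      have := congrArg (fun A : CStarMatrix (Fin n) (Fin n) M => A i j) h1.symm
      rw [CStarMatrix.mul_apply] at this
      exact this
    rw [sum_inner_of_factor σ _ (fun i j => s i j) hfac h, Complex.ofReal_re]
    have e1 : ∑ j, T (ξ j) (h j)
        = ∑ j, T (ξ j - ∑ i, MulOpposite.op ((g * s) i j) • ξ i) (h j)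
          + ∑ j, T (∑ i, MulOpposite.op (g i j) • ξ i) (∑ k, σ (s j k) (h k)) := by
      have e2 : ∀ i, ∑ j, σ ((g * s) i j) (h j) = ∑ j, σ (g i j) (∑ k, σ (s j k) (h k)) := by
        intro i
        simp only [CStarMatrix.mul_apply, map_sum, map_mul, sum_apply, mul_apply_eq_comp]
        exact Finset.sum_comm
      rw [hTb g, ← Finset.sum_congr rfl fun i _ => congrArg (T (ξ i)) (e2 i), ← hTb (g * s)]
      simp only [map_sub, sub_apply, Finset.sum_sub_distrib]
      abel
    rw [e1]
    refine (norm_add_le _ _).trans (add_le_add ?_ ?_)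
    · have h1 := hT.row (fun j => ξ j - ∑ i, MulOpposite.op ((g * s) i j) • ξ i) h
      rw [hgramsub _ hb] at h1
      rw [← Real.sqrt_mul hε.le]
      refine Real.le_sqrt_of_sq_le (h1.trans ?_)
      gcongr
    · have h1 := hT.row (fun j => ∑ i, MulOpposite.op (g i j) • ξ i)
        (fun j => ∑ k, σ (s j k) (h k))
      rw [hmulgram, hg] at h1
      refine Real.le_sqrt_of_sq_le (h1.trans ?_)
      refine mul_le_of_le_one_left (by positivity) hgG
  have hQ := InteriorTensor.gram_form_nonneg σ ξ h
  have lim : Filter.Tendsto (fun ε : ℝ => √ε * √(∑ j, ‖h j‖ ^ 2)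
      + √(∑ i, ∑ j, ⟪h i, σ (inner M (ξ i) (ξ j)) (h j)⟫_ℂ).re) (nhdsWithin 0 (Set.Ioi 0))
      (nhds (√0 * √(∑ j, ‖h j‖ ^ 2)
      + √(∑ i, ∑ j, ⟪h i, σ (inner M (ξ i) (ξ j)) (h j)⟫_ℂ).re)) :=
    tendsto_nhdsWithin_of_tendsto_nhds (Continuous.tendsto (by fun_prop) 0)
  have hfin := ge_of_tendsto lim (Filter.eventually_of_mem self_mem_nhdsWithin
    fun ε hε => main ε hε)
  rw [Real.sqrt_zero, zero_mul, zero_add] at hfin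
  calc _ ≤ √(∑ i, ∑ j, ⟪h i, σ (inner M (ξ i) (ξ j)) (h j)⟫_ℂ).re ^ 2 := by gcongr
    _ = _ := Real.sq_sqrt hQ

theorem IsCompletelyContractive.lift_bound (hT : IsCompletelyContractive M T)
    (hcov : ∀ (ξ : E) (a : M), T (MulOpposite.op a • ξ) = T ξ * σ a) (z : E ⊗[ℂ] H) :
    ‖TensorProduct.lift (ContinuousLinearMap.coeLM ℂ ∘ₗ T) z‖
      ≤ 1 * ‖InteriorTensor.incl E σ z‖ := by
  rw [one_mul]
  obtain ⟨k, ξ, h, rfl⟩ := TensorProduct.exists_sum_tmul_eq z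
  refine le_of_sq_le_sq ?_ (norm_nonneg _)
  rw [InteriorTensor.norm_incl_sq, interiorForm_sum]
  refine le_trans (le_of_eq ?_) (hT.norm_sum_sq_le hcov ξ h)
  simp

/-- The operator `T̃ : E ⊗_σ H → H`, `T̃ (ξ ⊗ h) = T ξ h`, of a completely contractive covariant `T`. -/
noncomputable def tildeOp (σ : M →⋆ₙₐ[ℂ] (H →L[ℂ] H)) (T : E →ₗ[ℂ] (H →L[ℂ] H)) :
    InteriorTensor E σ →L[ℂ] H :=
  InteriorTensor.lift σ (ContinuousLinearMap.coeLM ℂ ∘ₗ T)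

theorem tildeOp_tmul (hT : IsCompletelyContractive M T)
    (hcov : ∀ (ξ : E) (a : M), T (MulOpposite.op a • ξ) = T ξ * σ a) (ξ : E) (h : H) :
    tildeOp σ T (InteriorTensor.tmul σ ξ h) = T ξ h :=
  InteriorTensor.lift_tmul σ _ ⟨1, hT.lift_bound hcov⟩ ξ h

theorem norm_tildeOp_le (hT : IsCompletelyContractive M T)
    (hcov : ∀ (ξ : E) (a : M), T (MulOpposite.op a • ξ) = T ξ * σ a) : ‖tildeOp σ T‖ ≤ 1 :=
  LinearMap.opNorm_extendOfNorm_le (InteriorTensor.denseRange_incl σ) zero_le_one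
    (hT.lift_bound hcov)

end Contractive

end ITensor

/-! ## C⋆- and W⋆-correspondences -/

/-- The two settings: C⋆-algebras and W⋆-algebras. -/
inductive AStarKind
  | cstar
  | wstar

/-- `M` is an algebra of the given kind: in the W⋆-case, the C⋆-algebra `M` is (isometrically) the dual
of a Banach space; in the C⋆-case there is no condition. -/
def IsAStarAlgebra (k : AStarKind) (M : Type u) [NonUnitalCStarAlgebra M] : Prop :=
  k = .wstar → ∃ (Y : Type u) (_ : NormedAddCommGroup Y) (_ : NormedSpace ℂ Y)
    (_ : CompleteSpace Y), Nonempty (StrongDual ℂ Y ≃ₗᵢ⋆[ℂ] M)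

/-- A C⋆-correspondence over `M`: a complete right inner product module (Hilbert `M`-module) with a
nondegenerate left action of `M` by adjointable operators, i.e. a nondegenerate `⋆`-homomorphism
from `M` to the adjointable operators. (Additivity, `ℂ`-linearity and right `M`-linearity of each
operator `x ↦ a • x` follow from `inner_smul_left`.) -/
structure CStarCorrespondence (M : Type u) [NonUnitalCStarAlgebra M] [PartialOrder M] where
  carrier : Type v
  [normedAddCommGroup : NormedAddCommGroup carrier]
  [normedSpace : NormedSpace ℂ carrier]
  [completeSpace : CompleteSpace carrier]
  [leftSMul : SMul M carrier]
  [rightSMul : SMul Mᵐᵒᵖ carrier]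
  [rightInnerModule : RightInnerModule M carrier]
  norm_sq_eq : ∀ x : carrier, ‖x‖ ^ 2 = ‖(Inner.inner M x x : M)‖
  add_smul : ∀ (a b : M) (x : carrier), (a + b) • x = a • x + b • x
  complex_smul : ∀ (c : ℂ) (a : M) (x : carrier), (c • a) • x = c • (a • x)
  mul_smul : ∀ (a b : M) (x : carrier), (a * b) • x = a • (b • x)
  inner_smul_left : ∀ (a : M) (x y : carrier),
    (Inner.inner M (a • x) y : M) = Inner.inner M x (star a • y)
  nondegenerate :
    (Submodule.span ℂ {y : carrier | ∃ (a : M) (x : carrier), y = a • x}).topologicalClosure = ⊤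

namespace CStarCorrespondence

variable {M : Type u} [NonUnitalCStarAlgebra M] [PartialOrder M]

instance : CoeSort (CStarCorrespondence.{u, v} M) (Type v) := ⟨carrier⟩

attribute [instance] normedAddCommGroup normedSpace completeSpace leftSMul rightSMul
  rightInnerModule

/-- In the W⋆-case, `E` is a W⋆-correspondence: it is self-dual (each bounded right `M`-linear map
`E → M` is the inner product with a vector), and the left action is normal, i.e. `a ↦ ⟨x, a x⟩`
preserves suprema of (bounded) directed sets for each `x`. -/
structure IsOfKind (k : AStarKind) (E : CStarCorrespondence.{u, v} M) : Prop where
  selfDual : k = .wstar → ∀ f : E →L[ℂ] M, (∀ x a, f (MulOpposite.op a • x) = f x * a) →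
    ∃ y : E, ∀ x, f x = Inner.inner M y x
  normal : k = .wstar → ∀ x : E, ScottContinuous fun a : M => (Inner.inner M x (a • x) : M)

/-- Density of a subspace `V`: for the norm in the C⋆-case; in the W⋆-case for the topology of the
seminorms `x ↦ ω(⟨x, x⟩)^(1/2)`, where `ω` runs through the normal positive functionals on `M`. -/
def IsDense (k : AStarKind) (E : CStarCorrespondence.{u, v} M) (V : Submodule ℂ E) : Prop :=
  match k with
  | .cstar => V.topologicalClosure = ⊤
  | .wstar => ∀ ω : M →ₗ[ℂ] ℂ, (∀ a : M, 0 ≤ a → 0 ≤ (ω a).re ∧ (ω a).im = 0) →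
      ScottContinuous (fun a => (ω a).re) →
      ∀ (x : E) (ε : ℝ), 0 < ε → ∃ y ∈ V, (ω (Inner.inner M (x - y) (x - y))).re < ε

/-- `P`, with the bilinear map `t : (ζ, ξ) ↦ ζ ⊗ ξ`, is the (interior) tensor product of the
correspondences `E` and `F`. In the C⋆-case it is the completion of the span of the elementary tensors
in the inner product `⟨ζ₁ ⊗ ξ₁, ζ₂ ⊗ ξ₂⟩ = ⟨ξ₁, ⟨ζ₁, ζ₂⟩ ξ₂⟩`; in the W⋆-case it is the self-dual
extension of that. These properties determine `(P, t)` up to a unique unitary bimodule map. -/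
structure IsInteriorTensorProduct (k : AStarKind) (E F P : CStarCorrespondence.{u, v} M)
    (t : E →ₗ[ℂ] F →ₗ[ℂ] P) : Prop where
  isOfKind : P.IsOfKind k
  inner_tmul : ∀ (ζ₁ ζ₂ : E) (ξ₁ ξ₂ : F), (Inner.inner M (t ζ₁ ξ₁) (t ζ₂ ξ₂) : M)
    = Inner.inner M ξ₁ ((Inner.inner M ζ₁ ζ₂ : M) • ξ₂)
  balanced : ∀ (ζ : E) (a : M) (ξ : F), t (MulOpposite.op a • ζ) ξ = t ζ (a • ξ)
  smul_tmul : ∀ (a : M) (ζ : E) (ξ : F), a • t ζ ξ = t (a • ζ) ξ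
  op_smul_tmul : ∀ (a : M) (ζ : E) (ξ : F),
    MulOpposite.op a • t ζ ξ = t ζ (MulOpposite.op a • ξ)
  dense : P.IsDense k (Submodule.span ℂ {p : P | ∃ ζ ξ, p = t ζ ξ})

/-- The bilinear map `u` has the form `u ζ ξ = U (ζ ⊗ ξ)` for a coisometric adjointable bimodule map
`U : E ⊗ F → G`; here `V` is the adjoint of `U`, and coisometric means `U U⋆ = 1`. -/
def IsCoisometricProduct (k : AStarKind) {E F G : CStarCorrespondence.{u, v} M}
    (u : E →ₗ[ℂ] F →ₗ[ℂ] G) : Prop :=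
  ∃ (P : CStarCorrespondence.{u, v} M) (t : E →ₗ[ℂ] F →ₗ[ℂ] P) (U : P →ₗ[ℂ] G) (V : G →ₗ[ℂ] P),
    IsInteriorTensorProduct k E F P t ∧ (∀ ζ ξ, U (t ζ ξ) = u ζ ξ) ∧
    (∀ (a : M) (p : P), U (a • p) = a • U p) ∧
    (∀ (a : M) (p : P), U (MulOpposite.op a • p) = MulOpposite.op a • U p) ∧
    (∀ (p : P) (g : G), (Inner.inner M (U p) g : M) = Inner.inner M p (V g)) ∧
    ∀ g, U (V g) = g

end CStarCorrespondence

open CStarCorrespondence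

/-! ## Subproduct systems and their Fock spaces -/

/-- A subproduct system over `M`. The map `unit` is the identification `M = X(0)` of correspondences,
and `U n m ζ η` is `U_{n,m}(ζ ⊗ η)`. In a standard subproduct system, `X(n + m)` is an orthogonally
complemented sub-bimodule of `X(n) ⊗ X(m)` and `U_{n,m}` is the orthogonal projection onto it; so
this is the special case in which the adjoints of the `U_{n,m}` are inclusions. -/
structure SubproductSystem (k : AStarKind) (M : Type u) [NonUnitalCStarAlgebra M]
    [PartialOrder M] where
  X : ℕ → CStarCorrespondence.{u, v} M
  isOfKind : ∀ n, (X n).IsOfKind k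
  unit : M ≃ₗ[ℂ] X 0
  inner_unit : ∀ a b : M, (Inner.inner M (unit a) (unit b) : M) = star a * b
  smul_unit : ∀ a b : M, a • unit b = unit (a * b)
  op_smul_unit : ∀ a b : M, MulOpposite.op a • unit b = unit (b * a)
  U : ∀ n m, X n →ₗ[ℂ] X m →ₗ[ℂ] X (n + m)
  coisometric : ∀ n m, IsCoisometricProduct k (U n m)
  U_zero_right : ∀ n (ζ : X n) (a : M), U n 0 ζ (unit a) = MulOpposite.op a • ζ
  U_zero_left : ∀ n (ζ : X n) (a : M), HEq (U 0 n (unit a) ζ) (a • ζ)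
  assoc : ∀ n m l (ζ : X n) (η : X m) (θ : X l),
    HEq (U (n + m) l (U n m ζ η) θ) (U n (m + l) ζ (U m l η θ))

namespace SubproductSystem

variable {M : Type u} [NonUnitalCStarAlgebra M] [PartialOrder M] [StarOrderedRing M]
  {k : AStarKind}

/-- The algebraic Fock space `⨁ n, X(n)` (finite sums), the dense submodule of the Fock space `F_X`
from which `F_X` arises by completion. Its inner product is `⟨x, y⟩ = ∑ n, ⟨x n, y n⟩`. -/
def FockCore (X : SubproductSystem.{u, v} k M) : Type v := DirectSum ℕ fun n => X.X n

namespace FockCore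

variable (X : SubproductSystem.{u, v} k M)

noncomputable instance : AddCommGroup X.FockCore :=
  inferInstanceAs (AddCommGroup (DirectSum ℕ fun n => X.X n))

noncomputable instance : Module ℂ X.FockCore :=
  inferInstanceAs (Module ℂ (DirectSum ℕ fun n => X.X n))

theorem op_smul_zero {E : Type*} [AddCommGroup E] [Module ℂ E] [SMul Mᵐᵒᵖ E]
    [RightInnerModule M E] (a : M) : MulOpposite.op a • (0 : E) = 0 := by
  have h0 : ∀ x : E, inner M x (0 : E) = (0 : M) := fun x => by
    simpa using RightInnerModule.inner_smul_right (M := M) (0 : ℂ) x 0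
  apply RightInnerModule.inner_self_eq_zero (M := M)
  rw [RightInnerModule.inner_op_smul_right, h0, zero_mul]

noncomputable instance : SMul Mᵐᵒᵖ X.FockCore where
  smul a x := DFinsupp.mapRange (fun _ y => MulOpposite.op a.unop • y)
    (fun _ => op_smul_zero a.unop) x

variable {X}

/-- The component of `x` in `X(n)`. -/
def coord (x : X.FockCore) (n : ℕ) : X.X n := DFinsupp.toFun x n

theorem coord_add (x y : X.FockCore) (n : ℕ) : (x + y).coord n = x.coord n + y.coord n := rfl
theorem coord_smul (c : ℂ) (x : X.FockCore) (n : ℕ) : (c • x).coord n = c • x.coord n := rfl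
theorem coord_op_smul (a : M) (x : X.FockCore) (n : ℕ) :
    (MulOpposite.op a • x).coord n = MulOpposite.op a • x.coord n := rfl

theorem finite_support (x : X.FockCore) : {n | x.coord n ≠ 0}.Finite := DFinsupp.finite_support x

theorem ext_coord {x y : X.FockCore} (h : ∀ n, x.coord n = y.coord n) : x = y := DFinsupp.ext h

theorem inner_zero_right' {E : Type*} [AddCommGroup E] [Module ℂ E] [SMul Mᵐᵒᵖ E]
    [RightInnerModule M E] (x : E) : inner M x (0 : E) = (0 : M) := by
  simpa using RightInnerModule.inner_smul_right (M := M) (0 : ℂ) x 0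

theorem support_inner (x y : X.FockCore) :
    (Function.support fun n => (inner M (x.coord n) (y.coord n) : M)).Finite :=
  y.finite_support.subset fun n hn h0 => hn (by simp only [h0, inner_zero_right'])

noncomputable instance : RightInnerModule M X.FockCore where
  inner x y := ∑ᶠ n, inner M (x.coord n) (y.coord n)
  inner_add_right x y z := by
    rw [← finsum_add_distrib (support_inner x y) (support_inner x z)]
    simp only [coord_add, RightInnerModule.inner_add_right]
  inner_smul_right c x y := by
    rw [smul_finsum]
    simp only [coord_smul, RightInnerModule.inner_smul_right]
  inner_op_smul_right x y a := by
    simp only [coord_op_smul, RightInnerModule.inner_op_smul_right]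
    exact (finsum_mul' _ a (support_inner x y)).symm
  star_inner x y := by
    have := (starAddEquiv (R := M)).toAddMonoidHom.map_finsum (support_inner x y)
    refine this.trans (finsum_congr fun n => ?_)
    exact RightInnerModule.star_inner _ _
  inner_self_nonneg x := finsum_nonneg fun n => RightInnerModule.inner_self_nonneg _
  inner_self_eq_zero x hx := by
    refine ext_coord fun n => ?_
    rw [finsum_eq_sum_of_support_subset _
      (s := (insert n (support_inner x x).toFinset)) (by simp)] at hx
    have := (Finset.sum_eq_zero_iff_of_nonneg
      (fun m _ => RightInnerModule.inner_self_nonneg (M := M) (x.coord m))).mp hx n (by simp)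
    exact RightInnerModule.inner_self_eq_zero _ this

theorem inner_def (x y : X.FockCore) :
    inner M x y = ∑ᶠ n, (inner M (x.coord n) (y.coord n) : M) := rfl

variable (X) in
/-- The inclusion of `X(n)` in the Fock space. -/
noncomputable def of (n : ℕ) : X.X n →ₗ[ℂ] X.FockCore := DirectSum.lof ℂ ℕ (fun n => X.X n) n

theorem coord_of_same (n : ℕ) (ζ : X.X n) : (of X n ζ).coord n = ζ := DirectSum.of_eq_same _ _
theorem coord_of_ne {n m : ℕ} (h : m ≠ n) (ζ : X.X n) : (of X n ζ).coord m = 0 :=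
  DirectSum.of_eq_of_ne _ _ _ h

/-- Induction over homogeneous elements. -/
theorem induction {p : X.FockCore → Prop} (h0 : p 0) (hof : ∀ n ζ, p (of X n ζ))
    (hadd : ∀ x y, p x → p y → p (x + y)) (x : X.FockCore) : p x :=
  DirectSum.induction_on x h0 hof hadd

end FockCore

/-- The operator `S_n(ζ)`, `S_n(ζ) η = U_{n,m}(ζ ⊗ η)` for `η ∈ X(m)`. -/
noncomputable def creation (X : SubproductSystem.{u, v} k M) (n : ℕ) (ζ : X.X n) :
    X.FockCore →ₗ[ℂ] X.FockCore :=
  DirectSum.toModule ℂ ℕ X.FockCore fun m => FockCore.of X (n + m) ∘ₗ X.U n m ζ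

variable {X : SubproductSystem.{u, v} k M}

theorem creation_of (n m : ℕ) (ζ : X.X n) (η : X.X m) :
    X.creation n ζ (FockCore.of X m η) = FockCore.of X (n + m) (X.U n m ζ η) :=
  DirectSum.toModule_lof (M := fun n => X.X n) (N := X.FockCore)
    (φ := fun m => FockCore.of X (n + m) ∘ₗ X.U n m ζ) ℂ m η

theorem coord_creation (n m : ℕ) (ζ : X.X n) (x : X.FockCore) :
    (X.creation n ζ x).coord (n + m) = X.U n m ζ (x.coord m) := by
  induction x using FockCore.induction with
  | h0 =>
    rw [map_zero]
    exact (map_zero (X.U n m ζ)).symm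
  | hof l η =>
    rw [creation_of]
    by_cases h : m = l
    · subst h
      rw [FockCore.coord_of_same, FockCore.coord_of_same]
    · rw [FockCore.coord_of_ne (by omega), FockCore.coord_of_ne h, map_zero]
  | hadd x y hx hy => rw [map_add, FockCore.coord_add, FockCore.coord_add, hx, hy, map_add]

theorem coord_creation_of_lt {n l : ℕ} (h : l < n) (ζ : X.X n) (x : X.FockCore) :
    (X.creation n ζ x).coord l = 0 := by
  induction x using FockCore.induction with
  | h0 => rw [map_zero]; rfl
  | hof m η => rw [creation_of, FockCore.coord_of_ne (by omega)]
  | hadd x y hx hy => rw [map_add, FockCore.coord_add, hx, hy, add_zero]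

theorem inner_creation (n : ℕ) (ζ : X.X n) (x y : X.FockCore) :
    inner M (X.creation n ζ x) (X.creation n ζ y)
      = ∑ᶠ m, (inner M (X.U n m ζ (x.coord m)) (X.U n m ζ (y.coord m)) : M) := by
  rw [FockCore.inner_def]
  have h1 := finsum_mem_range (f := fun l => (inner M ((X.creation n ζ x).coord l)
    ((X.creation n ζ y).coord l) : M)) (g := fun m => n + m) (add_right_injective n)
  simp only [coord_creation] at h1
  rw [← h1]
  refine finsum_congr fun l => ?_
  by_cases hl : l ∈ Set.range fun m => n + m
  · simp [hl]
  · have hlt : l < n := by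
      by_contra h
      exact hl ⟨l - n, by simp; omega⟩
    rw [coord_creation_of_lt hlt ζ y, FockCore.inner_zero_right']
    simp [hl]

theorem exists_sqrt_defect {A : Type*} [NonUnitalCStarAlgebra A] [PartialOrder A]
    [StarOrderedRing A] {a : A} (ha : 0 ≤ a) {r : ℝ} (hr : 0 ≤ r) (hn : ‖a‖ ≤ r ^ 2) :
    ∃ e : A, star e = e ∧ a + e * e = ((2 * r : ℝ) : ℂ) • e := by
  have hsa : IsSelfAdjoint a := ha.isSelfAdjoint
  let f : ℝ → ℝ := fun t => r - √(r ^ 2 - t)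
  have cf : ContinuousOn f (quasispectrum ℝ a) := by fun_prop
  have f0 : f 0 = 0 := by simp [f, Real.sqrt_sq hr]
  have hq : ∀ t ∈ quasispectrum ℝ a, t ≤ r ^ 2 := fun t ht => by
    have h := norm_apply_le_norm_cfcₙ (fun t : ℝ => t) a ht
    rw [cfcₙ_id' ℝ a] at h
    exact (le_abs_self t).trans (h.trans hn)
  refine ⟨cfcₙ f a, (IsSelfAdjoint.cfcₙ).star_eq, ?_⟩
  have ci : ContinuousOn (fun t : ℝ => t) (quasispectrum ℝ a) := continuousOn_id
  have hid : cfcₙ (fun t : ℝ => t) a = a := cfcₙ_id' ℝ a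
  have h1 : cfcₙ (fun t => t + f t * f t) a = a + cfcₙ f a * cfcₙ f a := by
    rw [cfcₙ_add (fun t => t) (fun t => f t * f t) a ci rfl (cf.mul cf) (by simp [f0]),
      cfcₙ_mul f f a cf f0 cf f0, hid]
  have h2 : cfcₙ (fun t => (2 * r) • f t) a = (2 * r) • cfcₙ f a := cfcₙ_smul (2 * r) f a cf f0
  rw [← h1, Complex.coe_smul, ← h2]
  refine cfcₙ_congr fun t ht => ?_
  have h3 : √(r ^ 2 - t) * √(r ^ 2 - t) = r ^ 2 - t :=
    Real.mul_self_sqrt (by linarith [hq t ht])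
  simp only [f, smul_eq_mul]
  nlinarith

theorem inner_sub_sub {E : Type*} [AddCommGroup E] [Module ℂ E] [SMul Mᵐᵒᵖ E]
    [RightInnerModule M E] (x y z w : E) : (inner M (x - y) (z - w) : M)
      = inner M x z - inner M x w - inner M y z + inner M y w := by
  have hneg : ∀ x y : E, (inner M x (-y) : M) = - inner M x y := fun x y => by
    simpa using RightInnerModule.inner_smul_right (M := M) (-1 : ℂ) x y
  have hneg' : ∀ x y : E, (inner M (-x) y : M) = - inner M x y := fun x y => by
    simpa using RightInnerModule.inner_smul_left (M := M) (-1 : ℂ) x y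
  simp only [sub_eq_add_neg, RightInnerModule.inner_add_left,
    RightInnerModule.inner_add_right, hneg, hneg']
  abel

theorem exists_defect (n m : ℕ) (ζ : X.X n) :
    ∃ (P : CStarCorrespondence.{u, v} M) (q : X.X m → P) (b : X.X m → X.X m),
      ∀ η η' : X.X m, ((‖ζ‖ ^ 2 : ℝ) : ℂ) • (inner M η η' : M)
        = inner M (X.U n m ζ η) (X.U n m ζ η') + inner M (q η) (q η') + inner M (b η) (b η') := by
  obtain ⟨P, t, U, V, ht, hU, -, -, hUV, hV⟩ := X.coisometric n m
  obtain ⟨e, he, hae⟩ := exists_sqrt_defect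
    (RightInnerModule.inner_self_nonneg (M := M) ζ) (norm_nonneg ζ)
    ((X.X n).norm_sq_eq ζ).ge
  refine ⟨P, fun η => t ζ η - V (U (t ζ η)), fun η => ((‖ζ‖ : ℝ) : ℂ) • η - e • η,
    fun η η' => ?_⟩
  have hVU : ∀ p p' : P, (inner M (V (U p)) p' : M) = inner M (U p) (U p') := fun p p' => by
    rw [← RightInnerModule.star_inner, ← hUV, RightInnerModule.star_inner]
  have h1 : (inner M η ((inner M ζ ζ : M) • η') : M) + inner M η ((e * e) • η')
      = ((2 * ‖ζ‖ : ℝ) : ℂ) • inner M η (e • η') := by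
    rw [← RightInnerModule.inner_add_right, ← (X.X m).add_smul, hae, (X.X m).complex_smul,
      RightInnerModule.inner_smul_right]
  rw [inner_sub_sub, inner_sub_sub, ← hUV, hVU, ← hUV, hV, hU, hU, ht.inner_tmul,
    RightInnerModule.inner_smul_left, RightInnerModule.inner_smul_right,
    RightInnerModule.inner_smul_left, RightInnerModule.inner_smul_right,
    (X.X m).inner_smul_left, (X.X m).inner_smul_left, he, ← (X.X m).mul_smul,
    eq_sub_of_add_eq h1]
  push_cast
  simp only [Complex.star_def, Complex.conj_ofReal]
  module

section Creation

variable {D : Type w} [NormedAddCommGroup D] [InnerProductSpace ℂ D] [CompleteSpace D]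
  (π : M →⋆ₙₐ[ℂ] (D →L[ℂ] D))

theorem creation_component_le (n m : ℕ) (ζ : X.X n) {ι : Type*} [Fintype ι] (η : ι → X.X m)
    (d : ι → D) :
    (∑ i, ∑ j, ⟪d i, π (inner M (X.U n m ζ (η i)) (X.U n m ζ (η j))) (d j)⟫_ℂ).re
      ≤ ‖ζ‖ ^ 2 * (∑ i, ∑ j, ⟪d i, π (inner M (η i) (η j)) (d j)⟫_ℂ).re := by
  obtain ⟨P, q, b, h⟩ := X.exists_defect n m ζ
  have h1 := InteriorTensor.gram_form_nonneg π (fun i => q (η i)) d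
  have h2 := InteriorTensor.gram_form_nonneg π (fun i => b (η i)) d
  have h3 : ((‖ζ‖ ^ 2 : ℝ) : ℂ) * ∑ i, ∑ j, ⟪d i, π (inner M (η i) (η j)) (d j)⟫_ℂ
      = (∑ i, ∑ j, ⟪d i, π (inner M (X.U n m ζ (η i)) (X.U n m ζ (η j))) (d j)⟫_ℂ)
        + (∑ i, ∑ j, ⟪d i, π (inner M (q (η i)) (q (η j))) (d j)⟫_ℂ)
        + ∑ i, ∑ j, ⟪d i, π (inner M (b (η i)) (b (η j))) (d j)⟫_ℂ := by
    simp only [Finset.mul_sum, ← Finset.sum_add_distrib]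
    refine Finset.sum_congr rfl fun i _ => Finset.sum_congr rfl fun j _ => ?_
    rw [← inner_smul_right, ← smul_apply, ← map_smul, h]
    simp only [map_add, add_apply, inner_add_right]
  have h4 := congrArg Complex.re h3
  rw [Complex.re_ofReal_mul, Complex.add_re, Complex.add_re] at h4
  linarith

theorem creation_form_le (n : ℕ) (ζ : X.X n) {ι : Type*} [Fintype ι] (x : ι → X.FockCore)
    (d : ι → D) :
    (∑ i, ∑ j, ⟪d i, π (inner M (X.creation n ζ (x i)) (X.creation n ζ (x j))) (d j)⟫_ℂ).re
      ≤ ‖ζ‖ ^ 2 * (∑ i, ∑ j, ⟪d i, π (inner M (x i) (x j)) (d j)⟫_ℂ).re := by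
  classical
  let s : Finset ℕ := Finset.univ.biUnion fun i => (x i).finite_support.toFinset
  have hs : ∀ i m, m ∉ s → (x i).coord m = 0 := by
    intro i m hm
    by_contra h0
    exact hm (by simpa [s] using ⟨i, h0⟩)
  have e1 : ∀ i j, (inner M (x i) (x j) : M)
      = ∑ m ∈ s, inner M ((x i).coord m) ((x j).coord m) := fun i j => by
    rw [FockCore.inner_def]
    refine finsum_eq_sum_of_support_subset _ fun m hm => ?_
    by_contra h0
    exact hm (by simp only [hs j m h0, FockCore.inner_zero_right'])
  have e2 : ∀ i j, (inner M (X.creation n ζ (x i)) (X.creation n ζ (x j)) : M)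
      = ∑ m ∈ s, inner M (X.U n m ζ ((x i).coord m)) (X.U n m ζ ((x j).coord m)) := fun i j => by
    rw [inner_creation]
    refine finsum_eq_sum_of_support_subset _ fun m hm => ?_
    by_contra h0
    exact hm (by simp only [hs j m h0, map_zero, FockCore.inner_zero_right'])
  have swap : ∀ g : ℕ → ι → ι → M,
      (∑ i, ∑ j, ⟪d i, π (∑ m ∈ s, g m i j) (d j)⟫_ℂ).re
        = ∑ m ∈ s, (∑ i, ∑ j, ⟪d i, π (g m i j) (d j)⟫_ℂ).re := by
    intro g
    rw [← Complex.re_sum]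
    congr 1
    simp only [map_sum, sum_apply, inner_sum]
    rw [Finset.sum_congr rfl fun i _ => Finset.sum_comm, Finset.sum_comm]
  simp only [e1, e2]
  rw [swap fun m i j => inner M (X.U n m ζ ((x i).coord m)) (X.U n m ζ ((x j).coord m)),
    swap fun m i j => inner M ((x i).coord m) ((x j).coord m), Finset.mul_sum]
  exact Finset.sum_le_sum fun m _ => creation_component_le π n m ζ (fun i => (x i).coord m) d

/-- The Hilbert space `F_X ⊗_π D`. The completion of `F_X` need not be taken before tensoring with `D`:
the elementary tensors `x ⊗ d` with `x` in the algebraic Fock space span a dense subspace, in the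
C⋆-case for each `π` and in the W⋆-case for each normal `π`. -/
abbrev FockTensor (X : SubproductSystem.{u, v} k M) (π : M →⋆ₙₐ[ℂ] (D →L[ℂ] D)) :
    Type (max v w) :=
  InteriorTensor X.FockCore π

/-- The bounded operator `S_n(ζ) ⊗ I_D` on `F_X ⊗_π D`. -/
noncomputable def creationTensor (X : SubproductSystem.{u, v} k M)
    (π : M →⋆ₙₐ[ℂ] (D →L[ℂ] D)) (n : ℕ) (ζ : X.X n) :
    X.FockTensor π →L[ℂ] X.FockTensor π :=
  InteriorTensor.lift π
    (LinearMap.compl₁₂ (TensorProduct.mk ℂ X.FockCore D) (X.creation n ζ) LinearMap.id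
      |>.compr₂ (InteriorTensor.incl X.FockCore π))

theorem creationTensor_tmul (n : ℕ) (ζ : X.X n) (x : X.FockCore) (d : D) :
    X.creationTensor π n ζ (InteriorTensor.tmul π x d)
      = InteriorTensor.tmul π (X.creation n ζ x) d := by
  refine InteriorTensor.lift_tmul π _ ⟨‖ζ‖, fun z => ?_⟩ x d
  obtain ⟨k, y, h, rfl⟩ := TensorProduct.exists_sum_tmul_eq z
  refine le_of_sq_le_sq ?_ (by positivity)
  have e : ∀ (f : X.FockCore →ₗ[ℂ] D →ₗ[ℂ] X.FockTensor π),
      (∀ a b, f a b = InteriorTensor.incl X.FockCore π (X.creation n ζ a ⊗ₜ[ℂ] b)) →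
      TensorProduct.lift f (∑ j, y j ⊗ₜ[ℂ] h j)
        = InteriorTensor.incl X.FockCore π (∑ j, X.creation n ζ (y j) ⊗ₜ[ℂ] h j) := by
    intro f hf
    simp only [map_sum, TensorProduct.lift.tmul, hf]
  rw [e _ fun a b => rfl, mul_pow, InteriorTensor.norm_incl_sq, InteriorTensor.norm_incl_sq,
    interiorForm_sum, interiorForm_sum]
  exact creation_form_le π n ζ y h

end Creation

end SubproductSystem

/-! ## Covariant representations -/

/-- `π` is a representation of the C⋆- or W⋆-algebra `M`: it is nondegenerate and, in the W⋆-case,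
normal, i.e. `a ↦ ⟪h, π a h⟫` preserves suprema of (bounded) directed sets for each vector `h`. -/
structure IsNondegenerateRepresentation (k : AStarKind) {M : Type u} [NonUnitalCStarAlgebra M]
    [PartialOrder M] {H : Type w} [NormedAddCommGroup H] [InnerProductSpace ℂ H] [CompleteSpace H]
    (π : M →⋆ₙₐ[ℂ] (H →L[ℂ] H)) : Prop where
  nondegenerate :
    (Submodule.span ℂ {y : H | ∃ (a : M) (x : H), y = π a x}).topologicalClosure = ⊤
  normal : k = .wstar → ∀ h : H, ScottContinuous fun a : M => (⟪h, π a h⟫_ℂ).re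

/-- A completely contractive covariant representation `T = (T_n)` of `X` on `H`, with `T_0 = σ`. In the
W⋆-case `σ` is normal (by `isRep`); continuity of the `T n` for the `σ`-topology of `X(n)` and the
ultraweak topology is a consequence and not imposed separately. -/
structure CovariantRepresentation {k : AStarKind} {M : Type u} [NonUnitalCStarAlgebra M]
    [PartialOrder M] [StarOrderedRing M] (X : SubproductSystem.{u, v} k M) (H : Type w)
    [NormedAddCommGroup H] [InnerProductSpace ℂ H] [CompleteSpace H] where
  σ : M →⋆ₙₐ[ℂ] (H →L[ℂ] H)
  T : ∀ n, X.X n →ₗ[ℂ] (H →L[ℂ] H)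
  isRep : IsNondegenerateRepresentation k σ
  T_unit : ∀ a, T 0 (X.unit a) = σ a
  T_smul : ∀ n (a : M) (ζ : X.X n), T n (a • ζ) = σ a * T n ζ
  T_op_smul : ∀ n (ζ : X.X n) (a : M), T n (MulOpposite.op a • ζ) = T n ζ * σ a
  completelyContractive : ∀ n, IsCompletelyContractive M (T n)
  T_U : ∀ n m (ζ : X.X n) (η : X.X m), T (n + m) (X.U n m ζ η) = T n ζ * T m η

namespace CovariantRepresentation

variable {k : AStarKind} {M : Type u} [NonUnitalCStarAlgebra M]
  [PartialOrder M] [StarOrderedRing M] {X : SubproductSystem.{u, v} k M} {H : Type w}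
  [NormedAddCommGroup H] [InnerProductSpace ℂ H] [CompleteSpace H]
  (R : CovariantRepresentation X H)

/-- The contraction `T̃_n : X(n) ⊗_σ H → H`, `T̃_n (ζ ⊗ h) = T_n(ζ) h`. -/
noncomputable def tilde (n : ℕ) : InteriorTensor (X.X n) R.σ →L[ℂ] H :=
  tildeOp R.σ (R.T n)

theorem tilde_tmul (n : ℕ) (ζ : X.X n) (h : H) :
    R.tilde n (InteriorTensor.tmul R.σ ζ h) = R.T n ζ h :=
  tildeOp_tmul (R.completelyContractive n) (R.T_op_smul n) ζ h

/-- `T` is pure: `T̃_n T̃_n⋆ → 0` in the strong operator topology. -/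
def IsPure : Prop :=
  ∀ h : H, Filter.Tendsto (fun n => R.tilde n (ContinuousLinearMap.adjoint (R.tilde n) h))
    Filter.atTop (nhds 0)

/-- `S` is invariant for `σ(M)` and for all the operators `T_n(ζ)`, `n ≥ 1`. -/
def IsInvariant (S : Submodule ℂ H) : Prop :=
  (∀ (a : M), ∀ s ∈ S, R.σ a s ∈ S) ∧ ∀ n, 1 ≤ n → ∀ (ζ : X.X n), ∀ s ∈ S, R.T n ζ s ∈ S

end CovariantRepresentation

/-- A bounded operator is a partial isometry if it is isometric on the orthogonal complement of its
kernel. -/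
def IsPartialIsometry {K : Type*} {H : Type*} [NormedAddCommGroup K] [InnerProductSpace ℂ K]
    [NormedAddCommGroup H] [InnerProductSpace ℂ H] (A : K →L[ℂ] H) : Prop :=
  ∀ x ∈ (LinearMap.ker A.toLinearMap)ᗮ, ‖A x‖ = ‖x‖

/-!
If `W` intertwines `S ⊗ 1` with `T`, its range is invariant for every `T_n(ζ)`, and for `σ(M)` because
`T_0(M) = σ(M)`. The content is the converse.

The restriction of `T` to an invariant subspace is again a covariant representation, and it is again
pure (`CovariantRepresentation.restrict`, `CovariantRepresentation.IsPure.restrict`). It therefore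
suffices to find, for a pure `T` on `H`, a coisometry `F_X ⊗_σ H → H` that intertwines `S ⊗ 1`
with `T`. It is the adjoint of the Poisson kernel `K h = ∑ n, (1 ⊗ Δ) T̃_n⋆ h`, where
`Δ = (1 - T̃_1 T̃_1⋆)^(1/2)`; the defect operator `Δ` commutes with `σ(M)`, so that `1 ⊗ Δ` acts on
`X(n) ⊗_σ H`. One has `K⋆ (ζ ⊗ h) = T_n(ζ) Δ h` for `ζ ∈ X(n)`, and the intertwining relation is the
multiplicativity of `T`.

That `K` is isometric rests on the identity
`T̃_{n+m} T̃_{n+m}⋆ = T̃_n (1 ⊗ T̃_m T̃_m⋆) T̃_n⋆` (`CovariantRepresentation.norm_adjoint_tilde_add_sq`),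
a consequence of `U_{n,m} U_{n,m}⋆ = 1`. With `m = 1` it gives
`‖(1 ⊗ Δ) T̃_n⋆ h‖² = ‖T̃_n⋆ h‖² - ‖T̃_{n+1}⋆ h‖²`. The sum over `n` telescopes to `‖T̃_0⋆ h‖² = ‖h‖²`,
since `T̃_0` is unitary (`σ` is nondegenerate) and `‖T̃_n⋆ h‖ → 0` by purity.

The space `D` may be taken to be the subspace itself; passing to the closure of the range of `Δ` is
not needed.
-/

section

open scoped InnerProduct

/-! ### Bounded operators on interior tensor products -/

/-- A linear map `f` between inner product modules with
`r ⟨x, y⟩ = ⟨f x, f y⟩ + ⟨b x, b y⟩` for a scalar `r ≥ 0` and a map `b`. The second term makes the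
boundedness of `f` visible as a sum of squares, which survives the passage to Gram matrices, so `f`
induces an operator `f ⊗ 1` on interior tensor products (of norm at most `r ^ (1/2)`). -/
def HasBoundedForm (M : Type*) [NonUnitalCStarAlgebra M] [PartialOrder M] {E F : Type*}
    [AddCommGroup E] [Module ℂ E] [SMul Mᵐᵒᵖ E] [RightInnerModule M E]
    [AddCommGroup F] [Module ℂ F] [SMul Mᵐᵒᵖ F] [RightInnerModule M F] (f : E →ₗ[ℂ] F) : Prop :=
  ∃ r : ℝ, 0 ≤ r ∧ ∃ b : E → E, ∀ x y : E,
    (r : ℂ) • (inner M x y : M) = inner M (f x) (f y) + inner M (b x) (b y)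

namespace InteriorTensor

variable {M : Type u} [NonUnitalCStarAlgebra M] [PartialOrder M] [StarOrderedRing M]
  {E : Type*} [AddCommGroup E] [Module ℂ E] [SMul Mᵐᵒᵖ E] [RightInnerModule M E]
  {F : Type*} [AddCommGroup F] [Module ℂ F] [SMul Mᵐᵒᵖ F] [RightInnerModule M F]
  {H : Type*} [NormedAddCommGroup H] [InnerProductSpace ℂ H] [CompleteSpace H]
  {K : Type*} [NormedAddCommGroup K] [InnerProductSpace ℂ K] [CompleteSpace K]
  {π : M →⋆ₙₐ[ℂ] (H →L[ℂ] H)} {ρ : M →⋆ₙₐ[ℂ] (K →L[ℂ] K)}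

theorem clm_ext_tmul {L : Type*} [NormedAddCommGroup L] [InnerProductSpace ℂ L]
    {A B : InteriorTensor E π →L[ℂ] L}
    (h : ∀ ζ x, A (tmul π ζ x) = B (tmul π ζ x)) : A = B := by
  refine DFunLike.coe_injective ((denseRange_incl π).equalizer A.continuous
    B.continuous (funext fun z => ?_))
  induction z with
  | zero => simp
  | add a b ha hb => simpa using congrArg₂ (· + ·) ha hb
  | tmul ζ x => exact h ζ x

theorem ext_inner_tmul {x y : InteriorTensor E π}
    (h : ∀ ζ d, ⟪tmul π ζ d, x⟫_ℂ = ⟪tmul π ζ d, y⟫_ℂ) : x = y := by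
  have : innerSL ℂ x = innerSL ℂ y := clm_ext_tmul fun ζ d => by
    rw [innerSL_apply_apply, innerSL_apply_apply, ← inner_conj_symm, h, inner_conj_symm]
  refine ext_inner_right ℂ fun v => ?_
  simpa using congrArg (fun A => A v) this

theorem norm_sum_tmul_sq {ι : Type*} [Fintype ι] (ζ : ι → E) (h : ι → H) :
    ‖∑ i, tmul π (ζ i) (h i)‖ ^ 2 = (∑ i, ∑ j, ⟪h i, π (inner M (ζ i) (ζ j)) (h j)⟫_ℂ).re := by
  rw [← interiorForm_sum, ← norm_incl_sq, map_sum]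
  rfl

/-- A bilinear map on `E × H` is bounded for the norm of `E ⊗_π H` once it is so on finite sums of
elementary tensors. -/
theorem lift_tmul_of_sq_le (f : E →ₗ[ℂ] H →ₗ[ℂ] K) {C : ℝ} (hC : 0 ≤ C)
    (hf : ∀ (n : ℕ) (ζ : Fin n → E) (h : Fin n → H),
      ‖∑ i, f (ζ i) (h i)‖ ^ 2 ≤ C * ‖∑ i, tmul π (ζ i) (h i)‖ ^ 2) (ζ : E) (h : H) :
    lift π f (tmul π ζ h) = f ζ h := by
  refine lift_tmul π f ⟨√C, fun z => ?_⟩ ζ h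
  obtain ⟨k, ζ, h, rfl⟩ := TensorProduct.exists_sum_tmul_eq z
  refine le_of_sq_le_sq ?_ (by positivity)
  rw [mul_pow, Real.sq_sqrt hC]
  have := hf k ζ h
  simpa [map_sum, TensorProduct.lift.tmul, tmul] using this

variable (E) in
/-- The operator `1 ⊗ A : E ⊗_π H → E ⊗_ρ K` for an operator `A` intertwining `π` and `ρ`
(see `mapRight_tmul`). -/
noncomputable def mapRight (π : M →⋆ₙₐ[ℂ] (H →L[ℂ] H)) (ρ : M →⋆ₙₐ[ℂ] (K →L[ℂ] K))
    (A : H →L[ℂ] K) : InteriorTensor E π →L[ℂ] InteriorTensor E ρ :=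
  lift π ((TensorProduct.mk ℂ E H).compr₂ (incl E ρ ∘ₗ LinearMap.lTensor E A.toLinearMap))

theorem mapRight_tmul {A : H →L[ℂ] K} (hA : ∀ a x, A (π a x) = ρ a (A x)) (ζ : E) (x : H) :
    mapRight E π ρ A (tmul π ζ x) = tmul ρ ζ (A x) := by
  refine lift_tmul_of_sq_le _ (sq_nonneg ‖A‖) (fun n ζ h => ?_) ζ x
  obtain ⟨Z, hZ⟩ := RightInnerModule.exists_gram_eq (M := M) ζ
  have h1 : ‖∑ i, tmul ρ (ζ i) (A (h i))‖ ^ 2 ≤ ‖A‖ ^ 2 * ‖∑ i, tmul π (ζ i) (h i)‖ ^ 2 := by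
    rw [norm_sum_tmul_sq, norm_sum_tmul_sq, sum_inner_of_factor _ _ Z hZ,
      sum_inner_of_factor _ _ Z hZ, Complex.ofReal_re, Complex.ofReal_re, Finset.mul_sum]
    refine Finset.sum_le_sum fun k _ => ?_
    simp only [← hA, ← map_sum, ← mul_pow]
    gcongr
    exact A.le_opNorm _
  exact h1

/-- The operator `f ⊗ 1 : E ⊗_π H → F ⊗_π H` (see `mapLeft_tmul`). -/
noncomputable def mapLeft (π : M →⋆ₙₐ[ℂ] (H →L[ℂ] H)) (f : E →ₗ[ℂ] F) :
    InteriorTensor E π →L[ℂ] InteriorTensor F π :=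
  lift π ((TensorProduct.mk ℂ E H).compr₂ (incl F π ∘ₗ LinearMap.rTensor H f))

theorem mapLeft_tmul {f : E →ₗ[ℂ] F} (hf : HasBoundedForm M f) (ζ : E) (x : H) :
    mapLeft π f (tmul π ζ x) = tmul π (f ζ) x := by
  obtain ⟨r, hr, b, hb⟩ := hf
  refine lift_tmul_of_sq_le _ hr (fun n ζ h => ?_) ζ x
  have h1 : ‖∑ i, tmul π (f (ζ i)) (h i)‖ ^ 2 ≤ r * ‖∑ i, tmul π (ζ i) (h i)‖ ^ 2 := by
    rw [norm_sum_tmul_sq, norm_sum_tmul_sq]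
    have h2 := gram_form_nonneg π (fun i => b (ζ i)) h
    have h3 : (r : ℂ) * ∑ i, ∑ j, ⟪h i, π (inner M (ζ i) (ζ j)) (h j)⟫_ℂ
        = (∑ i, ∑ j, ⟪h i, π (inner M (f (ζ i)) (f (ζ j))) (h j)⟫_ℂ)
          + ∑ i, ∑ j, ⟪h i, π (inner M (b (ζ i)) (b (ζ j))) (h j)⟫_ℂ := by
      simp only [Finset.mul_sum, ← Finset.sum_add_distrib]
      refine Finset.sum_congr rfl fun i _ => Finset.sum_congr rfl fun j _ => ?_
      rw [← inner_smul_right, ← smul_apply, ← map_smul, hb]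
      simp only [map_add, add_apply, inner_add_right]
    have h4 := congrArg Complex.re h3
    rw [Complex.re_ofReal_mul, Complex.add_re] at h4
    linarith
  exact h1

/-- An operator that preserves inner products of elementary tensors is isometric. -/
theorem norm_map_of_inner_tmul {A : InteriorTensor E π →L[ℂ] K}
    (hA : ∀ ζ η x y, ⟪A (tmul π ζ x), A (tmul π η y)⟫_ℂ = ⟪tmul π ζ x, tmul π η y⟫_ℂ)
    (z : InteriorTensor E π) : ‖A z‖ = ‖z‖ := by
  refine (ContinuousLinearMap.norm_map_iff_adjoint_comp_self A).mpr ?_ z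
  refine clm_ext_tmul fun η y => ext_inner_tmul fun ζ x => ?_
  rw [ContinuousLinearMap.comp_apply, ContinuousLinearMap.adjoint_inner_right, hA]
  rfl

end InteriorTensor

theorem HasBoundedForm.of_inner_eq {M : Type*} [NonUnitalCStarAlgebra M] [PartialOrder M]
    {E F : Type*}
    [AddCommGroup E] [Module ℂ E] [SMul Mᵐᵒᵖ E] [RightInnerModule M E]
    [AddCommGroup F] [Module ℂ F] [SMul Mᵐᵒᵖ F] [RightInnerModule M F] {f : E →ₗ[ℂ] F}
    (hf : ∀ x y, (inner M (f x) (f y) : M) = inner M x y) : HasBoundedForm M f := by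
  refine ⟨1, zero_le_one, fun _ => 0, fun x y => ?_⟩
  have h0 : (inner M (0 : E) (0 : E) : M) = 0 := by
    simpa using RightInnerModule.inner_smul_right (M := M) (0 : ℂ) (0 : E) 0
  simp only [hf, h0, Complex.ofReal_one, one_smul, add_zero]

/-! ### The left action on a correspondence -/

namespace CStarCorrespondence

variable {M : Type u} [NonUnitalCStarAlgebra M] [PartialOrder M] [StarOrderedRing M]
  (E : CStarCorrespondence.{u, v} M)

theorem ext_inner_module {E : Type*} [AddCommGroup E] [Module ℂ E] [SMul Mᵐᵒᵖ E]
    [RightInnerModule M E] {x y : E} (h : ∀ z : E, (inner M z x : M) = inner M z y) : x = y := by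
  have h1 : (inner M (x - y) (x - y) : M) = 0 := by
    rw [SubproductSystem.inner_sub_sub, h x, h y]
    abel
  exact sub_eq_zero.mp (RightInnerModule.inner_self_eq_zero _ h1)

theorem inner_smul_right' (a : M) (x y : E) :
    (inner M x (a • y) : M) = inner M (star a • x) y := by
  rw [E.inner_smul_left, star_star]

/-- The operator `x ↦ a • x` on a correspondence; it is linear because it has an adjoint. -/
def leftMul (a : M) : E →ₗ[ℂ] E where
  toFun x := a • x
  map_add' x y := ext_inner_module (M := M) fun z => by
    rw [RightInnerModule.inner_add_right, inner_smul_right', inner_smul_right',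
      inner_smul_right', RightInnerModule.inner_add_right]
  map_smul' c x := ext_inner_module (M := M) fun z => by
    rw [RingHom.id_apply, RightInnerModule.inner_smul_right, inner_smul_right',
      inner_smul_right', RightInnerModule.inner_smul_right]

/-- A map whose form is `⟨x, a y⟩` with `a ≥ 0` is bounded: if `e = ‖a‖^(1/2) - (‖a‖ - a)^(1/2)` then
`‖a‖ - a = (‖a‖^(1/2) - e)²`, in terms that only involve `M` and not its unitization. -/
theorem hasBoundedForm_of_inner_eq_smul {F : Type*} [AddCommGroup F] [Module ℂ F] [SMul Mᵐᵒᵖ F]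
    [RightInnerModule M F] {f : E →ₗ[ℂ] F} {a : M} (ha : 0 ≤ a)
    (hf : ∀ x y : E, (inner M (f x) (f y) : M) = inner M x (a • y)) : HasBoundedForm M f := by
  obtain ⟨e, he, hae⟩ := SubproductSystem.exists_sqrt_defect ha (Real.sqrt_nonneg ‖a‖)
    (Real.sq_sqrt (norm_nonneg a)).ge
  refine ⟨√‖a‖ ^ 2, by positivity, fun x => ((√‖a‖ : ℝ) : ℂ) • x - e • x, fun x y => ?_⟩
  have h1 : (inner M x (a • y) : M) + inner M x ((e * e) • y)
      = ((2 * √‖a‖ : ℝ) : ℂ) • inner M x (e • y) := by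
    rw [← RightInnerModule.inner_add_right, ← E.add_smul, hae, E.complex_smul,
      RightInnerModule.inner_smul_right]
  rw [hf, SubproductSystem.inner_sub_sub, RightInnerModule.inner_smul_left,
    RightInnerModule.inner_smul_right, RightInnerModule.inner_smul_left,
    RightInnerModule.inner_smul_right, E.inner_smul_left, E.inner_smul_left, he, ← E.mul_smul,
    eq_sub_of_add_eq h1]
  push_cast
  simp only [Complex.star_def, Complex.conj_ofReal]
  module

theorem hasBoundedForm_leftMul (a : M) : HasBoundedForm M (E.leftMul a) :=
  E.hasBoundedForm_of_inner_eq_smul (star_mul_self_nonneg a) fun x y => by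
    rw [E.mul_smul]
    exact E.inner_smul_left a x (a • y)

theorem IsInteriorTensorProduct.hasBoundedForm {k : AStarKind}
    {E F P : CStarCorrespondence.{u, v} M} {t : E →ₗ[ℂ] F →ₗ[ℂ] P}
    (ht : IsInteriorTensorProduct k E F P t) (ζ : E) : HasBoundedForm M (t ζ) :=
  F.hasBoundedForm_of_inner_eq_smul (RightInnerModule.inner_self_nonneg ζ) fun x y =>
    ht.inner_tmul ζ ζ x y

end CStarCorrespondence

/-! ### Total sets in `P ⊗_σ H` -/

namespace InteriorTensor

variable {M : Type u} [NonUnitalCStarAlgebra M] [PartialOrder M] [StarOrderedRing M]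
  {H : Type*} [NormedAddCommGroup H] [InnerProductSpace ℂ H] [CompleteSpace H]
  {π : M →⋆ₙₐ[ℂ] (H →L[ℂ] H)}

section

variable {E : Type*} [AddCommGroup E] [Module ℂ E] [SMul Mᵐᵒᵖ E] [RightInnerModule M E]

theorem tmul_add_left (ζ η : E) (x : H) : tmul π (ζ + η) x = tmul π ζ x + tmul π η x := by
  simp [tmul, TensorProduct.add_tmul]

theorem tmul_smul_left (c : ℂ) (ζ : E) (x : H) : tmul π (c • ζ) x = c • tmul π ζ x := by
  rw [tmul, ← TensorProduct.smul_tmul', map_smul, tmul]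

theorem tmul_sub_left (ζ η : E) (x : H) : tmul π (ζ - η) x = tmul π ζ x - tmul π η x := by
  simp [tmul, TensorProduct.sub_tmul]

theorem tmul_zero_left (x : H) : tmul π (0 : E) x = 0 := by
  simp [tmul]

theorem norm_tmul_sq (ζ : E) (x : H) : ‖tmul π ζ x‖ ^ 2 = (⟪x, π (inner M ζ ζ) x⟫_ℂ).re := by
  rw [← inner_tmul, ← inner_self_eq_norm_sq (𝕜 := ℂ)]
  rfl

end

theorem norm_tmul_le (E : CStarCorrespondence.{u, v} M) (ζ : E) (x : H) :
    ‖tmul π ζ x‖ ≤ ‖ζ‖ * ‖x‖ := by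
  refine le_of_sq_le_sq ?_ (by positivity)
  rw [norm_tmul_sq, mul_pow, E.norm_sq_eq, sq, ← mul_assoc, mul_comm]
  refine (Complex.re_le_norm _).trans ((norm_inner_le_norm _ _).trans ?_)
  gcongr
  refine (ContinuousLinearMap.le_opNorm _ _).trans ?_
  gcongr
  exact NonUnitalStarAlgHom.norm_apply_le π _

/-- If `V` is dense in `E`, in the sense appropriate to the kind, then elementary tensors can be
approximated in norm with first factor in `V`. In the W⋆-case this is where normality of `π`
enters: `‖ζ ⊗ x‖² = ω ⟨ζ, ζ⟩` for the normal positive functional `ω = ⟪x, π(·) x⟫`. -/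
theorem exists_norm_tmul_sub_lt {k : AStarKind} (hπ : IsNondegenerateRepresentation k π)
    {E : CStarCorrespondence.{u, v} M} {V : Submodule ℂ E} (hV : E.IsDense k V) (ζ : E) (x : H)
    {ε : ℝ} (hε : 0 < ε) : ∃ η ∈ V, ‖tmul π (ζ - η) x‖ < ε := by
  cases k with
  | cstar =>
    have h1 : ζ ∈ closure (V : Set E) := by
      have : ζ ∈ V.topologicalClosure := by
        rw [show V.topologicalClosure = ⊤ from hV]
        trivial
      exact this
    obtain ⟨η, hη, hd⟩ := Metric.mem_closure_iff.mp h1 (ε / (‖x‖ + 1)) (by positivity)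
    refine ⟨η, hη, (norm_tmul_le E _ x).trans_lt ?_⟩
    rw [dist_eq_norm, lt_div_iff₀ (by positivity)] at hd
    nlinarith [norm_nonneg (ζ - η), norm_nonneg x]
  | wstar =>
    let ω : M →ₗ[ℂ] ℂ :=
      { toFun := fun a => ⟪x, π a x⟫_ℂ
        map_add' := fun a b => by simp
        map_smul' := fun c a => by simp }
    obtain ⟨η, hη, h⟩ := hV ω (fun a ha => by
      obtain ⟨b, rfl⟩ := RightInnerModule.exists_star_mul_self ha
      have h1 : ω (star b * b) = ((‖π b x‖ ^ 2 : ℝ) : ℂ) := by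
        change ⟪x, π (star b * b) x⟫_ℂ = _
        rw [map_mul, map_star, ContinuousLinearMap.star_eq_adjoint, mul_apply_eq_comp,
          ContinuousLinearMap.adjoint_inner_right, inner_self_eq_norm_sq_to_K]
        push_cast
        rfl
      rw [h1]
      exact ⟨by rw [Complex.ofReal_re]; positivity, Complex.ofReal_im _⟩)
      (hπ.normal rfl x) ζ (ε ^ 2) (by positivity)
    refine ⟨η, hη, ?_⟩
    have h2 : ‖tmul π (ζ - η) x‖ ^ 2 < ε ^ 2 := by
      rw [norm_tmul_sq]
      exact h
    exact lt_of_pow_lt_pow_left₀ 2 hε.le h2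

theorem ext_inner_tmul_of_isInteriorTensorProduct {k : AStarKind}
    (hπ : IsNondegenerateRepresentation k π) {E F P : CStarCorrespondence.{u, v} M}
    {t : E →ₗ[ℂ] F →ₗ[ℂ] P} (ht : IsInteriorTensorProduct k E F P t) {x y : InteriorTensor P π}
    (h : ∀ ζ η d, ⟪tmul π (t ζ η) d, x⟫_ℂ = ⟪tmul π (t ζ η) d, y⟫_ℂ) : x = y := by
  refine ext_inner_tmul fun p d => ?_
  have hspan : ∀ q ∈ Submodule.span ℂ {p : P | ∃ ζ ξ, p = t ζ ξ},
      ⟪tmul π q d, x - y⟫_ℂ = 0 := by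
    intro q hq
    induction hq using Submodule.span_induction with
    | mem q hq =>
      obtain ⟨ζ, η, rfl⟩ := hq
      rw [inner_sub_right, h, sub_self]
    | zero => rw [tmul_zero_left, inner_zero_left]
    | add a b _ _ ha hb => rw [tmul_add_left, inner_add_left, ha, hb, add_zero]
    | smul c a _ ha => rw [tmul_smul_left, _root_.inner_smul_left, ha, mul_zero]
  rw [← sub_eq_zero, ← inner_sub_right, ← norm_eq_zero]
  refine le_antisymm (le_of_forall_pos_le_add fun ε hε => ?_) (norm_nonneg _)
  obtain ⟨q, hq, hlt⟩ := exists_norm_tmul_sub_lt hπ ht.dense p d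
    (show 0 < ε / (‖x - y‖ + 1) by positivity)
  have h1 : ⟪tmul π p d, x - y⟫_ℂ = ⟪tmul π (p - q) d, x - y⟫_ℂ := by
    rw [tmul_sub_left, inner_sub_left, hspan q hq, sub_zero]
  rw [h1, zero_add]
  refine (norm_inner_le_norm _ _).trans ?_
  rw [lt_div_iff₀ (by positivity)] at hlt
  nlinarith [norm_nonneg (tmul π (p - q) d), norm_nonneg (x - y)]

end InteriorTensor

/-! ### The operators `T̃_n T̃_n⋆` -/

namespace CovariantRepresentation

open InteriorTensor

variable {k : AStarKind} {M : Type u} [NonUnitalCStarAlgebra M]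
  [PartialOrder M] [StarOrderedRing M] {X : SubproductSystem.{u, v} k M} {H : Type w}
  [NormedAddCommGroup H] [InnerProductSpace ℂ H] [CompleteSpace H]
  (R : CovariantRepresentation X H)

/-- The operator `Q_n = T̃_n T̃_n⋆`. -/
noncomputable def rangeOp (n : ℕ) : H →L[ℂ] H := R.tilde n ∘L (R.tilde n)†

theorem tilde_comp_mapLeft_leftMul (n : ℕ) (a : M) :
    R.tilde n ∘L mapLeft R.σ ((X.X n).leftMul a) = R.σ a ∘L R.tilde n := by
  refine clm_ext_tmul fun ζ h => ?_
  rw [ContinuousLinearMap.comp_apply, ContinuousLinearMap.comp_apply,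
    mapLeft_tmul ((X.X n).hasBoundedForm_leftMul a), tilde_tmul, tilde_tmul]
  exact congrArg (fun A => A h) (R.T_smul n a ζ)

theorem adjoint_mapLeft_leftMul (E : CStarCorrespondence.{u, v} M) (π : M →⋆ₙₐ[ℂ] (H →L[ℂ] H))
    (a : M) : (mapLeft π (E.leftMul a))† = mapLeft π (E.leftMul (star a)) := by
  refine clm_ext_tmul fun η y => ext_inner_tmul fun ζ x => ?_
  rw [ContinuousLinearMap.adjoint_inner_right, mapLeft_tmul (E.hasBoundedForm_leftMul a),
    mapLeft_tmul (E.hasBoundedForm_leftMul _), inner_tmul, inner_tmul]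
  exact congrArg (fun b => ⟪x, π b y⟫_ℂ) (E.inner_smul_left a ζ η)

theorem rangeOp_comp (n : ℕ) (a : M) : R.rangeOp n ∘L R.σ a = R.σ a ∘L R.rangeOp n := by
  have h1 := congrArg ContinuousLinearMap.adjoint (R.tilde_comp_mapLeft_leftMul n (star a))
  rw [ContinuousLinearMap.adjoint_comp, ContinuousLinearMap.adjoint_comp,
    adjoint_mapLeft_leftMul, star_star, map_star, ContinuousLinearMap.star_eq_adjoint,
    ContinuousLinearMap.adjoint_adjoint] at h1
  rw [rangeOp, ContinuousLinearMap.comp_assoc, ← h1, ← ContinuousLinearMap.comp_assoc,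
    tilde_comp_mapLeft_leftMul, ContinuousLinearMap.comp_assoc]

theorem rangeOp_σ (n : ℕ) (a : M) (x : H) : R.rangeOp n (R.σ a x) = R.σ a (R.rangeOp n x) :=
  congrArg (fun A => A x) (R.rangeOp_comp n a)

section Factor

variable {n m : ℕ} {P : CStarCorrespondence.{u, v} M} {t : X.X n →ₗ[ℂ] X.X m →ₗ[ℂ] P}

theorem adjoint_mapLeft_comp_mapLeft (ht : IsInteriorTensorProduct k (X.X n) (X.X m) P t)
    (ζ ζ' : X.X n) : (mapLeft R.σ (t ζ))† ∘L mapLeft R.σ (t ζ')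
      = mapLeft R.σ ((X.X m).leftMul (inner M ζ ζ')) := by
  refine clm_ext_tmul fun η y => ext_inner_tmul fun θ x => ?_
  rw [ContinuousLinearMap.comp_apply, ContinuousLinearMap.adjoint_inner_right,
    mapLeft_tmul (ht.hasBoundedForm ζ), mapLeft_tmul (ht.hasBoundedForm ζ'),
    mapLeft_tmul ((X.X m).hasBoundedForm_leftMul _), inner_tmul, inner_tmul, ht.inner_tmul]
  rfl

/-- The bilinear map `(ζ, h) ↦ ζ ⊗ T̃_m⋆ h` underlying `factorOp`. -/
noncomputable def factorForm (ht : IsInteriorTensorProduct k (X.X n) (X.X m) P t) :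
    X.X n →ₗ[ℂ] H →ₗ[ℂ] InteriorTensor P R.σ :=
  LinearMap.mk₂ ℂ (fun ζ h => mapLeft R.σ (t ζ) (((R.tilde m)†) h))
    (fun ζ ζ' h => by
      have : mapLeft R.σ (t (ζ + ζ')) = mapLeft R.σ (t ζ) + mapLeft R.σ (t ζ') :=
        clm_ext_tmul fun η x => by
          rw [add_apply, mapLeft_tmul (ht.hasBoundedForm _),
            mapLeft_tmul (ht.hasBoundedForm _), mapLeft_tmul (ht.hasBoundedForm _), map_add,
            LinearMap.add_apply, tmul_add_left]
      rw [this, add_apply])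
    (fun c ζ h => by
      have : mapLeft R.σ (t (c • ζ)) = c • mapLeft R.σ (t ζ) :=
        clm_ext_tmul fun η x => by
          rw [smul_apply, mapLeft_tmul (ht.hasBoundedForm _),
            mapLeft_tmul (ht.hasBoundedForm _), map_smul, LinearMap.smul_apply, tmul_smul_left]
      rw [this, smul_apply])
    (fun ζ h h' => by rw [map_add, map_add])
    (fun c ζ h => by rw [map_smul, map_smul])

theorem inner_factorForm (ht : IsInteriorTensorProduct k (X.X n) (X.X m) P t) (ζ ζ' : X.X n)
    (h h' : H) : ⟪R.factorForm ht ζ h, R.factorForm ht ζ' h'⟫_ℂ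
      = ⟪tmul R.σ ζ h, mapRight (X.X n) R.σ R.σ (R.rangeOp m) (tmul R.σ ζ' h')⟫_ℂ := by
  have h1 : ⟪R.factorForm ht ζ h, R.factorForm ht ζ' h'⟫_ℂ
      = ⟪h, (R.tilde m ∘L ((mapLeft R.σ (t ζ))† ∘L mapLeft R.σ (t ζ'))) (((R.tilde m)†) h')⟫_ℂ := by
    rw [ContinuousLinearMap.comp_apply, ← ContinuousLinearMap.adjoint_inner_left,
      ContinuousLinearMap.comp_apply, ContinuousLinearMap.adjoint_inner_right]
    rfl
  rw [h1, adjoint_mapLeft_comp_mapLeft R ht, tilde_comp_mapLeft_leftMul,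
    mapRight_tmul fun a x => R.rangeOp_σ m a x, inner_tmul]
  rfl

/-- The operator `1 ⊗ T̃_m⋆ : X(n) ⊗_σ H → X(n) ⊗ X(m) ⊗_σ H`, where `P` is the tensor product
`X(n) ⊗ X(m)`. -/
noncomputable def factorOp (ht : IsInteriorTensorProduct k (X.X n) (X.X m) P t) :
    InteriorTensor (X.X n) R.σ →L[ℂ] InteriorTensor P R.σ :=
  lift R.σ (R.factorForm ht)

theorem factorOp_tmul (ht : IsInteriorTensorProduct k (X.X n) (X.X m) P t) (ζ : X.X n) (h : H) :
    R.factorOp ht (tmul R.σ ζ h) = mapLeft R.σ (t ζ) (((R.tilde m)†) h) := by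
  refine lift_tmul_of_sq_le (R.factorForm ht)
    (norm_nonneg (mapRight (X.X n) R.σ R.σ (R.rangeOp m))) (fun l ζ h => ?_) ζ h
  have h1 : ⟪∑ i, R.factorForm ht (ζ i) (h i), ∑ i, R.factorForm ht (ζ i) (h i)⟫_ℂ
      = ⟪∑ i, tmul R.σ (ζ i) (h i),
        mapRight (X.X n) R.σ R.σ (R.rangeOp m) (∑ i, tmul R.σ (ζ i) (h i))⟫_ℂ := by
    simp only [map_sum, inner_sum, sum_inner, inner_factorForm]
  rw [← inner_self_eq_norm_sq (𝕜 := ℂ), h1]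
  refine (Complex.re_le_norm _).trans ((norm_inner_le_norm _ _).trans ?_)
  rw [sq, mul_left_comm]
  gcongr
  exact (mapRight (X.X n) R.σ R.σ (R.rangeOp m)).le_opNorm _

theorem adjoint_factorOp_comp (ht : IsInteriorTensorProduct k (X.X n) (X.X m) P t) :
    (R.factorOp ht)† ∘L R.factorOp ht = mapRight (X.X n) R.σ R.σ (R.rangeOp m) := by
  refine clm_ext_tmul fun η y => ext_inner_tmul fun ζ x => ?_
  rw [ContinuousLinearMap.comp_apply, ContinuousLinearMap.adjoint_inner_right, factorOp_tmul,
    factorOp_tmul]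
  exact R.inner_factorForm ht ζ η x y

/-- The adjoint of `1 ⊗ T̃_m⋆` is `ζ ⊗ η ⊗ h ↦ ζ ⊗ T_m(η) h`. -/
theorem inner_tmul_factorOp (ht : IsInteriorTensorProduct k (X.X n) (X.X m) P t) (ζ : X.X n)
    (η : X.X m) (h : H) (w : InteriorTensor (X.X n) R.σ) :
    ⟪tmul R.σ (t ζ η) h, R.factorOp ht w⟫_ℂ = ⟪tmul R.σ ζ (R.T m η h), w⟫_ℂ := by
  rw [← ContinuousLinearMap.adjoint_inner_left]
  congr 1
  refine ext_inner_tmul fun ζ' h' => ?_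
  rw [ContinuousLinearMap.adjoint_inner_right, factorOp_tmul, inner_tmul,
    ← mapLeft_tmul (ht.hasBoundedForm ζ), ← ContinuousLinearMap.adjoint_inner_right,
    ← ContinuousLinearMap.comp_apply, adjoint_mapLeft_comp_mapLeft R ht,
    mapLeft_tmul ((X.X m).hasBoundedForm_leftMul _), ContinuousLinearMap.adjoint_inner_left,
    tilde_tmul]
  exact congrArg (fun A => ⟪h', A h⟫_ℂ) (R.T_smul m _ η)

end Factor

/-- `T̃_{n+m} T̃_{n+m}⋆ = T̃_n (1 ⊗ T̃_m T̃_m⋆) T̃_n⋆`. With `V` the adjoint of the coisometry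
`U_{n,m}`, the operator `V ⊗ 1` is isometric, and `(V ⊗ 1) T̃_{n+m}⋆ = (1 ⊗ T̃_m⋆) T̃_n⋆` because
`T` is multiplicative. -/
theorem norm_adjoint_tilde_add_sq (n m : ℕ) (h : H) : ‖((R.tilde (n + m))†) h‖ ^ 2
    = (⟪((R.tilde n)†) h,
      mapRight (X.X n) R.σ R.σ (R.rangeOp m) (((R.tilde n)†) h)⟫_ℂ).re := by
  obtain ⟨P, t, U, V, ht, hU, -, -, hUV, hV⟩ := X.coisometric n m
  have hVi : ∀ g g', (inner M (V g) (V g') : M) = inner M g g' := fun g g' => by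
    rw [← hUV, hV]
  have hVb : HasBoundedForm M V := .of_inner_eq hVi
  have hiso : ∀ z, ‖mapLeft R.σ V z‖ = ‖z‖ := norm_map_of_inner_tmul fun ζ η x y => by
    rw [mapLeft_tmul hVb, mapLeft_tmul hVb, inner_tmul, inner_tmul, hVi]
  have hadj : ∀ p x w, ⟪tmul R.σ p x, mapLeft R.σ V w⟫_ℂ = ⟪tmul R.σ (U p) x, w⟫_ℂ := by
    intro p x w
    rw [← ContinuousLinearMap.adjoint_inner_left]
    congr 1
    refine ext_inner_tmul fun ζ y => ?_
    rw [ContinuousLinearMap.adjoint_inner_right, mapLeft_tmul hVb, inner_tmul, inner_tmul,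
      ← RightInnerModule.star_inner, ← hUV, RightInnerModule.star_inner]
  have key : mapLeft R.σ V (((R.tilde (n + m))†) h) = R.factorOp ht (((R.tilde n)†) h) := by
    refine ext_inner_tmul_of_isInteriorTensorProduct R.isRep ht fun ζ η x => ?_
    rw [hadj, hU, inner_tmul_factorOp, ContinuousLinearMap.adjoint_inner_right,
      ContinuousLinearMap.adjoint_inner_right, tilde_tmul, tilde_tmul, R.T_U]
    rfl
  rw [← hiso, key, ← adjoint_factorOp_comp R ht, ContinuousLinearMap.comp_apply,
    ContinuousLinearMap.adjoint_inner_right, ← inner_self_eq_norm_sq (𝕜 := ℂ)]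
  rfl

end CovariantRepresentation

/-! ### Isometries and partial isometries -/

theorem adjoint_linearIsometry_apply {K H : Type*} [NormedAddCommGroup K]
    [InnerProductSpace ℂ K] [CompleteSpace K] [NormedAddCommGroup H] [InnerProductSpace ℂ H]
    [CompleteSpace H] (A : H →ₗᵢ[ℂ] K) (y : H) : (A.toContinuousLinearMap†) (A y) = y := by
  have h1 := (ContinuousLinearMap.norm_map_iff_adjoint_comp_self A.toContinuousLinearMap).mp
    A.norm_map
  exact congrArg (fun B : H →L[ℂ] H => B y) h1

/-- The adjoint of an isometry, followed by an isometry, is a partial isometry. -/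
theorem isPartialIsometry_comp_adjoint {K H L : Type*} [NormedAddCommGroup K]
    [InnerProductSpace ℂ K] [CompleteSpace K] [NormedAddCommGroup H] [InnerProductSpace ℂ H]
    [CompleteSpace H] [NormedAddCommGroup L] [InnerProductSpace ℂ L]
    (J : H →ₗᵢ[ℂ] L) (A : H →ₗᵢ[ℂ] K) :
    IsPartialIsometry (J.toContinuousLinearMap ∘L (A.toContinuousLinearMap†)) := by
  intro x hx
  have hker : LinearMap.ker (J.toContinuousLinearMap ∘L (A.toContinuousLinearMap†)).toLinearMap
      = LinearMap.ker (A.toContinuousLinearMap†).toLinearMap := by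
    ext y
    exact map_eq_zero_iff J J.injective
  have hclosed : IsClosed ((LinearMap.range A.toLinearMap : Submodule ℂ K) : Set K) :=
    A.isometry.isClosedEmbedding.isClosed_range
  rw [hker, ContinuousLinearMap.orthogonal_ker, ContinuousLinearMap.adjoint_adjoint] at hx
  obtain ⟨y, rfl⟩ : x ∈ LinearMap.range A.toLinearMap := by
    rwa [← hclosed.submodule_topologicalClosure_eq]
  change ‖J ((A.toContinuousLinearMap†) (A y))‖ = ‖A y‖
  rw [adjoint_linearIsometry_apply, J.norm_map, A.norm_map]

/-! ### The operator `T̃_0` and purity -/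

namespace CovariantRepresentation

open InteriorTensor

variable {k : AStarKind} {M : Type u} [NonUnitalCStarAlgebra M]
  [PartialOrder M] [StarOrderedRing M] {X : SubproductSystem.{u, v} k M} {H : Type w}
  [NormedAddCommGroup H] [InnerProductSpace ℂ H] [CompleteSpace H]
  (R : CovariantRepresentation X H)

theorem T_zero_apply (ζ : X.X 0) : R.T 0 ζ = R.σ (X.unit.symm ζ) := by
  rw [← R.T_unit, LinearEquiv.apply_symm_apply]

theorem norm_tilde_zero (z : InteriorTensor (X.X 0) R.σ) : ‖R.tilde 0 z‖ = ‖z‖ := by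
  refine norm_map_of_inner_tmul (fun ζ η x y => ?_) z
  obtain ⟨a, rfl⟩ := X.unit.surjective ζ
  obtain ⟨b, rfl⟩ := X.unit.surjective η
  rw [tilde_tmul, tilde_tmul, R.T_unit, R.T_unit, inner_tmul, X.inner_unit, map_mul, map_star,
    ContinuousLinearMap.star_eq_adjoint, mul_apply_eq_comp,
    ContinuousLinearMap.adjoint_inner_right]

/-- `T̃_0` is the canonical isometry `M ⊗_σ H → H`, unitary because `σ` is nondegenerate. -/
theorem norm_adjoint_tilde_zero (h : H) : ‖((R.tilde 0)†) h‖ = ‖h‖ := by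
  have hdense : (LinearMap.range (R.tilde 0).toLinearMap).topologicalClosure = ⊤ := by
    refine top_le_iff.mp (R.isRep.nondegenerate.symm.le.trans
      (Submodule.topologicalClosure_mono (Submodule.span_le.mpr ?_)))
    rintro _ ⟨a, x, rfl⟩
    refine ⟨tmul R.σ (X.unit a) x, ?_⟩
    rw [← R.T_unit]
    exact R.tilde_tmul 0 _ _
  have hclosed : IsClosed {h : H | ‖((R.tilde 0)†) h‖ = ‖h‖} :=
    isClosed_eq (by fun_prop) (by fun_prop)
  have hsub : ((LinearMap.range (R.tilde 0).toLinearMap : Submodule ℂ H) : Set H)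
      ⊆ {h : H | ‖((R.tilde 0)†) h‖ = ‖h‖} := by
    rintro _ ⟨z, rfl⟩
    have h1 := (ContinuousLinearMap.norm_map_iff_adjoint_comp_self (R.tilde 0)).mp
      R.norm_tilde_zero
    have h2 : ((R.tilde 0)†) (R.tilde 0 z) = z := congrArg (fun A => A z) h1
    change ‖((R.tilde 0)†) (R.tilde 0 z)‖ = ‖R.tilde 0 z‖
    rw [h2, R.norm_tilde_zero]
  have hmem : h ∈ (LinearMap.range (R.tilde 0).toLinearMap).topologicalClosure := by
    rw [hdense]
    trivial
  exact closure_minimal hsub hclosed hmem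

theorem norm_adjoint_tilde_le (n : ℕ) (h : H) : ‖((R.tilde n)†) h‖ ≤ ‖h‖ := by
  refine (ContinuousLinearMap.le_opNorm _ h).trans (mul_le_of_le_one_left (norm_nonneg h) ?_)
  rw [LinearIsometryEquiv.norm_map]
  exact norm_tildeOp_le (R.completelyContractive n) (R.T_op_smul n)

theorem inner_rangeOp (n : ℕ) (h : H) :
    (⟪h, R.rangeOp n h⟫_ℂ).re = ‖((R.tilde n)†) h‖ ^ 2 := by
  rw [rangeOp, ContinuousLinearMap.comp_apply, ← ContinuousLinearMap.adjoint_inner_left,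
    ← inner_self_eq_norm_sq (𝕜 := ℂ)]
  rfl

theorem isPure_iff : R.IsPure ↔
    ∀ h, Filter.Tendsto (fun n => ‖((R.tilde n)†) h‖ ^ 2) Filter.atTop (nhds 0) := by
  constructor
  · intro hR h
    have h1 : Filter.Tendsto (fun n => (⟪h, R.rangeOp n h⟫_ℂ).re) Filter.atTop
        (nhds (⟪h, (0 : H)⟫_ℂ).re) :=
      (Complex.continuous_re.tendsto _).comp (tendsto_const_nhds.inner (hR h))
    simpa only [inner_rangeOp, inner_zero_right, Complex.zero_re] using h1
  · intro hR h
    refine squeeze_zero_norm (fun n => ?_)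
      (by simpa using (hR h).sqrt : Filter.Tendsto (fun n => ‖((R.tilde n)†) h‖) _ _)
    refine ((R.tilde n).le_opNorm _).trans (mul_le_of_le_one_left (norm_nonneg _) ?_)
    exact norm_tildeOp_le (R.completelyContractive n) (R.T_op_smul n)

/-! ### The defect operator -/

/-- The defect operator `Δ = (1 - T̃_1 T̃_1⋆)^(1/2)`. -/
noncomputable def defect : H →L[ℂ] H := CFC.sqrt (1 - R.rangeOp 1)

theorem one_sub_rangeOp_nonneg : 0 ≤ 1 - R.rangeOp 1 := by
  rw [ContinuousLinearMap.nonneg_iff_isPositive, ContinuousLinearMap.isPositive_def']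
  refine ⟨(IsSelfAdjoint.one _).sub
    (ContinuousLinearMap.isPositive_self_comp_adjoint (R.tilde 1)).isSelfAdjoint, fun h => ?_⟩
  rw [ContinuousLinearMap.reApplyInnerSelf_apply, sub_apply, one_apply_eq_self, inner_sub_left,
    map_sub, inner_self_eq_norm_sq, inner_re_symm (𝕜 := ℂ)]
  have h1 := R.inner_rangeOp 1 h
  have h2 := R.norm_adjoint_tilde_le 1 h
  have h3 : ‖((R.tilde 1)†) h‖ ^ 2 ≤ ‖h‖ ^ 2 := by gcongr
  change 0 ≤ ‖h‖ ^ 2 - (⟪h, R.rangeOp 1 h⟫_ℂ).re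
  linarith

theorem defect_mul_self : R.defect * R.defect = 1 - R.rangeOp 1 :=
  CFC.sqrt_mul_sqrt_self _ R.one_sub_rangeOp_nonneg

theorem inner_defect (x y : H) : ⟪R.defect x, y⟫_ℂ = ⟪x, R.defect y⟫_ℂ := by
  have h1 : IsSelfAdjoint R.defect := (CFC.sqrt_nonneg (1 - R.rangeOp 1)).isSelfAdjoint
  rw [← ContinuousLinearMap.adjoint_inner_right, ← ContinuousLinearMap.star_eq_adjoint,
    h1.star_eq]

theorem defect_σ (a : M) (x : H) : R.defect (R.σ a x) = R.σ a (R.defect x) := by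
  have h1 : Commute (1 - R.rangeOp 1) (R.σ a) :=
    (Commute.one_left _).sub_left (R.rangeOp_comp 1 a)
  have h2 : Commute R.defect (R.σ a) := h1.cfcₙ_nnreal NNReal.sqrt
  exact congrArg (fun A => A x) h2.eq

/-- The operator `1 ⊗ Δ` on `X(n) ⊗_σ H`. -/
noncomputable def defectTensor (n : ℕ) :
    InteriorTensor (X.X n) R.σ →L[ℂ] InteriorTensor (X.X n) R.σ :=
  mapRight (X.X n) R.σ R.σ R.defect

theorem defectTensor_tmul (n : ℕ) (ζ : X.X n) (x : H) :
    R.defectTensor n (tmul R.σ ζ x) = tmul R.σ ζ (R.defect x) :=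
  mapRight_tmul R.defect_σ ζ x

theorem adjoint_defectTensor (n : ℕ) : (R.defectTensor n)† = R.defectTensor n := by
  refine clm_ext_tmul fun η y => ext_inner_tmul fun ζ x => ?_
  rw [ContinuousLinearMap.adjoint_inner_right, defectTensor_tmul, defectTensor_tmul, inner_tmul,
    inner_tmul, inner_defect, defect_σ]

theorem adjoint_defectTensor_comp (n : ℕ) : (R.defectTensor n)† ∘L R.defectTensor n
    = ContinuousLinearMap.id ℂ _ - mapRight (X.X n) R.σ R.σ (R.rangeOp 1) := by
  refine clm_ext_tmul fun ζ x => ?_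
  have h1 : R.defect (R.defect x) = x - R.rangeOp 1 x := congrArg (fun A => A x) R.defect_mul_self
  rw [adjoint_defectTensor, ContinuousLinearMap.comp_apply, defectTensor_tmul, defectTensor_tmul,
    h1, sub_apply, mapRight_tmul fun a x => R.rangeOp_σ 1 a x, ContinuousLinearMap.id_apply]
  simp only [tmul, TensorProduct.tmul_sub, map_sub]

theorem norm_defectTensor_sq (n : ℕ) (h : H) : ‖R.defectTensor n (((R.tilde n)†) h)‖ ^ 2
    = ‖((R.tilde n)†) h‖ ^ 2 - ‖((R.tilde (n + 1))†) h‖ ^ 2 := by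
  rw [ContinuousLinearMap.apply_norm_sq_eq_inner_adjoint_right, adjoint_defectTensor_comp,
    sub_apply, inner_sub_right, map_sub, norm_adjoint_tilde_add_sq, ContinuousLinearMap.id_apply,
    inner_self_eq_norm_sq]
  rfl

variable {R} in
theorem hasSum_norm_defectTensor_sq (hR : R.IsPure) (h : H) :
    HasSum (fun n => ‖R.defectTensor n (((R.tilde n)†) h)‖ ^ 2) (‖h‖ ^ 2) := by
  rw [hasSum_iff_tendsto_nat_of_nonneg fun n => by positivity]
  have h1 : ∀ N, ∑ n ∈ Finset.range N, ‖R.defectTensor n (((R.tilde n)†) h)‖ ^ 2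
      = ‖h‖ ^ 2 - ‖((R.tilde N)†) h‖ ^ 2 := by
    intro N
    simp only [norm_defectTensor_sq]
    rw [Finset.sum_range_sub' (fun n => ‖((R.tilde n)†) h‖ ^ 2), norm_adjoint_tilde_zero]
  simp only [h1]
  simpa using tendsto_const_nhds.sub (R.isPure_iff.mp hR h)

/-! ### The Poisson kernel -/

theorem inner_fockCore_of (n : ℕ) (ζ η : X.X n) :
    (inner M (SubproductSystem.FockCore.of X n ζ) (SubproductSystem.FockCore.of X n η) : M)
      = inner M ζ η := by
  rw [SubproductSystem.FockCore.inner_def, finsum_eq_single _ n fun m hm => by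
    rw [SubproductSystem.FockCore.coord_of_ne hm η,
      SubproductSystem.FockCore.inner_zero_right'],
    SubproductSystem.FockCore.coord_of_same, SubproductSystem.FockCore.coord_of_same]

theorem inner_fockCore_of_ne {n m : ℕ} (hnm : n ≠ m) (ζ : X.X n) (η : X.X m) :
    (inner M (SubproductSystem.FockCore.of X n ζ) (SubproductSystem.FockCore.of X m η) : M)
      = 0 := by
  rw [SubproductSystem.FockCore.inner_def]
  refine finsum_eq_zero_of_forall_eq_zero fun l => ?_
  by_cases hl : l = m
  · subst hl
    rw [← RightInnerModule.star_inner, SubproductSystem.FockCore.coord_of_ne hnm.symm ζ,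
      SubproductSystem.FockCore.inner_zero_right', star_zero]
  · rw [SubproductSystem.FockCore.coord_of_ne hl η, SubproductSystem.FockCore.inner_zero_right']

/-- The isometric inclusion of `X(n) ⊗_π H` in `F_X ⊗_π H`. -/
noncomputable def fockIncl (X : SubproductSystem.{u, v} k M) (π : M →⋆ₙₐ[ℂ] (H →L[ℂ] H)) (n : ℕ) :
    InteriorTensor (X.X n) π →ₗᵢ[ℂ] X.FockTensor π where
  toLinearMap := (mapLeft π (SubproductSystem.FockCore.of X n)).toLinearMap
  norm_map' := norm_map_of_inner_tmul fun ζ η x y => by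
    have hb : HasBoundedForm M (SubproductSystem.FockCore.of X n) :=
      .of_inner_eq (inner_fockCore_of n)
    rw [mapLeft_tmul hb, mapLeft_tmul hb, inner_tmul, inner_tmul, inner_fockCore_of]

theorem fockIncl_tmul (π : M →⋆ₙₐ[ℂ] (H →L[ℂ] H)) (n : ℕ) (ζ : X.X n) (x : H) :
    fockIncl X π n (tmul π ζ x) = tmul π (SubproductSystem.FockCore.of X n ζ) x :=
  mapLeft_tmul (.of_inner_eq (inner_fockCore_of n)) ζ x

theorem orthogonalFamily_fockIncl (π : M →⋆ₙₐ[ℂ] (H →L[ℂ] H)) :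
    OrthogonalFamily ℂ (fun n => InteriorTensor (X.X n) π) (fockIncl X π) := by
  intro n m hnm v w
  have h1 : ((fockIncl X π n).toContinuousLinearMap)† ∘L (fockIncl X π m).toContinuousLinearMap
      = 0 := by
    refine clm_ext_tmul fun η y => ext_inner_tmul fun ζ x => ?_
    rw [ContinuousLinearMap.comp_apply, ContinuousLinearMap.adjoint_inner_right,
      LinearIsometry.coe_toContinuousLinearMap, LinearIsometry.coe_toContinuousLinearMap,
      fockIncl_tmul, fockIncl_tmul, inner_tmul, inner_fockCore_of_ne hnm]
    simp
  have h2 := congrArg (fun A => ⟪v, A w⟫_ℂ) h1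
  simpa [ContinuousLinearMap.adjoint_inner_right] using h2

variable {R}

/-- The sequence `((1 ⊗ Δ) T̃_n⋆ h)_n` of components of the Poisson kernel. For pure `T` its norm is
`‖h‖`, because the squares of the norms telescope. -/
noncomputable def poissonSeq (hR : R.IsPure) :
    H →ₗᵢ[ℂ] lp (fun n => InteriorTensor (X.X n) R.σ) 2 where
  toFun h := ⟨fun n => R.defectTensor n (((R.tilde n)†) h), memℓp_gen (by
    simpa using (hasSum_norm_defectTensor_sq hR h).summable)⟩
  map_add' x y := Subtype.ext (funext fun n => by simp only [map_add]; rfl)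
  map_smul' c x := Subtype.ext (funext fun n => by simp)
  norm_map' h := by
    have h1 := lp.norm_rpow_eq_tsum (p := 2) (by norm_num)
      (⟨fun n => R.defectTensor n (((R.tilde n)†) h), memℓp_gen (by
        simpa using (hasSum_norm_defectTensor_sq hR h).summable)⟩ :
        lp (fun n => InteriorTensor (X.X n) R.σ) 2)
    simp only [ENNReal.toReal_ofNat, Real.rpow_ofNat] at h1
    rw [(hasSum_norm_defectTensor_sq hR h).tsum_eq] at h1
    exact (sq_eq_sq₀ (norm_nonneg _) (norm_nonneg _)).mp h1

/-- The Poisson kernel `h ↦ ∑ n, (1 ⊗ Δ) T̃_n⋆ h`, an isometry `H → F_X ⊗_σ H` for pure `T`. -/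
noncomputable def poissonKernel (hR : R.IsPure) : H →ₗᵢ[ℂ] X.FockTensor R.σ :=
  (orthogonalFamily_fockIncl R.σ).linearIsometry.comp (poissonSeq hR)

theorem adjoint_poissonKernel_tmul (hR : R.IsPure) (n : ℕ) (ζ : X.X n) (x : H) :
    ((poissonKernel hR).toContinuousLinearMap†)
      (tmul R.σ (SubproductSystem.FockCore.of X n ζ) x) = R.T n ζ (R.defect x) := by
  classical
  refine ext_inner_left ℂ fun h => ?_
  rw [ContinuousLinearMap.adjoint_inner_right, LinearIsometry.coe_toContinuousLinearMap,
    ← fockIncl_tmul, ← (orthogonalFamily_fockIncl R.σ).linearIsometry_apply_single,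
    poissonKernel]
  change ⟪(orthogonalFamily_fockIncl R.σ).linearIsometry (poissonSeq hR h), _⟫_ℂ = _
  rw [LinearIsometry.inner_map_map, lp.inner_single_right]
  change ⟪R.defectTensor n (((R.tilde n)†) h), tmul R.σ ζ x⟫_ℂ = _
  rw [← ContinuousLinearMap.adjoint_inner_right, adjoint_defectTensor, defectTensor_tmul,
    ContinuousLinearMap.adjoint_inner_left, tilde_tmul]

/-- The adjoint of the Poisson kernel intertwines the shift `S ⊗ 1` with `T`. -/
theorem adjoint_poissonKernel_comp_creationTensor (hR : R.IsPure) (n : ℕ) (ζ : X.X n) :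
    ((poissonKernel hR).toContinuousLinearMap†) ∘L X.creationTensor R.σ n ζ
      = R.T n ζ ∘L ((poissonKernel hR).toContinuousLinearMap†) := by
  refine clm_ext_tmul fun η x => ?_
  rw [ContinuousLinearMap.comp_apply, ContinuousLinearMap.comp_apply,
    SubproductSystem.creationTensor_tmul]
  induction η using SubproductSystem.FockCore.induction with
  | h0 => simp only [map_zero, tmul_zero_left]
  | hof m η =>
    rw [SubproductSystem.creation_of, adjoint_poissonKernel_tmul, adjoint_poissonKernel_tmul,
      R.T_U]
    rfl
  | hadd a b ha hb => simp only [map_add, tmul_add_left, ha, hb]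

/-! ### Restriction to an invariant subspace -/

variable {S : Submodule ℂ H}

theorem IsInvariant.T_mem (hinv : R.IsInvariant S) (n : ℕ) (ζ : X.X n) : ∀ s ∈ S, R.T n ζ s ∈ S := by
  rcases n with _ | n
  · rw [T_zero_apply]
    exact hinv.1 _
  · exact hinv.2 (n + 1) (by omega) ζ

variable [CompleteSpace S]

/-- The restriction of `σ` to an invariant subspace. -/
noncomputable def restrictσ (hinv : R.IsInvariant S) : M →⋆ₙₐ[ℂ] (S →L[ℂ] S) where
  toFun a := (R.σ a).restrict (hinv.1 a)
  map_smul' c a := by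
    ext s
    simp
  map_zero' := by
    ext s
    simp
  map_add' a b := by
    ext s
    simp
  map_mul' a b := by
    ext s
    simp
  map_star' a := by
    rw [ContinuousLinearMap.star_eq_adjoint, ContinuousLinearMap.eq_adjoint_iff]
    intro x y
    simp only [Submodule.coe_inner, ContinuousLinearMap.coe_restrict_apply, map_star,
      ContinuousLinearMap.star_eq_adjoint, ContinuousLinearMap.adjoint_inner_left]

theorem coe_restrictσ (hinv : R.IsInvariant S) (a : M) (s : S) :
    (restrictσ hinv a s : H) = R.σ a s := rfl

/-- Nondegeneracy passes to an invariant subspace `S`: if `s ∈ S` is orthogonal to `σ(M) S` then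
`‖σ(a) s‖² = ⟪σ(a⋆ a) s, s⟫ = 0` for all `a`, so that `s` is orthogonal to `σ(M) H`. -/
theorem isNondegenerateRepresentation_restrictσ (hinv : R.IsInvariant S) :
    IsNondegenerateRepresentation k (restrictσ hinv) where
  nondegenerate := by
    rw [Submodule.topologicalClosure_eq_top_iff, Submodule.eq_bot_iff]
    intro s hs
    have h0 : ∀ a, R.σ a s = 0 := fun a => by
      have h1 := (Submodule.mem_orthogonal _ s).mp hs (restrictσ hinv (star a * a) s)
        (Submodule.subset_span ⟨_, _, rfl⟩)
      rw [Submodule.coe_inner, coe_restrictσ, map_mul, map_star,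
        ContinuousLinearMap.star_eq_adjoint, mul_apply_eq_comp,
        ContinuousLinearMap.adjoint_inner_left] at h1
      exact inner_self_eq_zero.mp h1
    have h2 : (s : H) ∈ (Submodule.span ℂ {y : H | ∃ (a : M) (x : H), y = R.σ a x})ᗮ := by
      rw [Submodule.mem_orthogonal]
      intro y hy
      induction hy using Submodule.span_induction with
      | mem y hy =>
        obtain ⟨a, x, rfl⟩ := hy
        rw [← ContinuousLinearMap.adjoint_inner_right, ← ContinuousLinearMap.star_eq_adjoint,
          ← map_star, h0, inner_zero_right]
      | zero => exact inner_zero_left _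
      | add a b _ _ ha hb => rw [inner_add_left, ha, hb, add_zero]
      | smul c a _ ha => rw [_root_.inner_smul_left, ha, mul_zero]
    rw [Submodule.topologicalClosure_eq_top_iff.mp R.isRep.nondegenerate] at h2
    exact Subtype.ext ((Submodule.mem_bot ℂ).mp h2)
  normal hk s := R.isRep.normal hk s

/-- The restriction of a covariant representation to an invariant subspace. -/
noncomputable def restrict (hinv : R.IsInvariant S) : CovariantRepresentation X S where
  σ := restrictσ hinv
  T n :=
    { toFun := fun ζ => (R.T n ζ).restrict (hinv.T_mem n ζ)
      map_add' := fun ζ η => by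
        ext s
        simp
      map_smul' := fun c ζ => by
        ext s
        simp }
  isRep := isNondegenerateRepresentation_restrictσ hinv
  T_unit a := by
    ext s
    exact congrArg (fun A => A (s : H)) (R.T_unit a)
  T_smul n a ζ := by
    ext s
    exact congrArg (fun A => A (s : H)) (R.T_smul n a ζ)
  T_op_smul n ζ a := by
    ext s
    exact congrArg (fun A => A (s : H)) (R.T_op_smul n ζ a)
  completelyContractive n l ξ h := by
    simpa using R.completelyContractive n l ξ fun j => (h j : H)
  T_U n m ζ η := by
    ext s
    exact congrArg (fun A => A (s : H)) (R.T_U n m ζ η)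

/-- If `J : X(n) ⊗ S → X(n) ⊗ H` is the inclusion, then `T̃_n⋆` for the restriction is `J⋆ T̃_n⋆`;
hence purity is inherited. -/
theorem IsPure.restrict (hR : R.IsPure) (hinv : R.IsInvariant S) :
    (restrict hinv).IsPure := by
  rw [isPure_iff] at hR ⊢
  intro s
  refine squeeze_zero (fun n => by positivity) (fun n => ?_) (hR s)
  have hι : ∀ a x, S.subtypeL ((CovariantRepresentation.restrict hinv).σ a x)
      = R.σ a (S.subtypeL x) := fun a x => rfl
  let J := mapRight (X.X n) (CovariantRepresentation.restrict hinv).σ R.σ S.subtypeL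
  have hJ : ∀ z, ‖J z‖ = ‖z‖ := norm_map_of_inner_tmul fun ζ η x y => by
    rw [mapRight_tmul hι, mapRight_tmul hι, inner_tmul, inner_tmul, ← hι]
    rfl
  have hT : S.subtypeL ∘L (CovariantRepresentation.restrict hinv).tilde n = R.tilde n ∘L J :=
    clm_ext_tmul fun ζ x => by
      rw [ContinuousLinearMap.comp_apply, ContinuousLinearMap.comp_apply, mapRight_tmul hι,
        tilde_tmul, tilde_tmul]
      rfl
  have h1 : (((CovariantRepresentation.restrict hinv).tilde n)†) s
      = (J†) (((R.tilde n)†) s) := by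
    refine ext_inner_left ℂ fun z => ?_
    rw [ContinuousLinearMap.adjoint_inner_right, ContinuousLinearMap.adjoint_inner_right,
      ContinuousLinearMap.adjoint_inner_right, ← ContinuousLinearMap.comp_apply, ← hT]
    rfl
  have h2 : ‖J†‖ ≤ 1 := by
    rw [LinearIsometryEquiv.norm_map]
    exact J.opNorm_le_bound zero_le_one fun z => by rw [hJ, one_mul]
  rw [h1]
  gcongr
  exact ((J†).le_opNorm _).trans (mul_le_of_le_one_left (norm_nonneg _) h2)

end CovariantRepresentation

/-! ### Invariant subspaces as ranges of intertwining partial isometries -/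

theorem theorem3p1 (k : AStarKind) {M : Type u} [NonUnitalCStarAlgebra M] [PartialOrder M]
    [StarOrderedRing M] (hM : IsAStarAlgebra k M) (X : SubproductSystem.{u, v} k M)
    {H : Type w} [NormedAddCommGroup H] [InnerProductSpace ℂ H] [CompleteSpace H]
    (R : CovariantRepresentation X H) (hR : R.IsPure)
    (S : Submodule ℂ H) (hS : IsClosed (S : Set H)) (hS0 : S ≠ ⊥) :
    R.IsInvariant S ↔
      ∃ (D : Type w) (_ : NormedAddCommGroup D) (_ : InnerProductSpace ℂ D) (_ : CompleteSpace D)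
        (π : M →⋆ₙₐ[ℂ] (D →L[ℂ] D)) (W : X.FockTensor π →L[ℂ] H),
        IsNondegenerateRepresentation k π ∧ IsPartialIsometry W ∧
        LinearMap.range W.toLinearMap = S ∧
        ∀ (n : ℕ) (ζ : X.X n), W ∘L X.creationTensor π n ζ = R.T n ζ ∘L W := by
  constructor
  · intro hinv
    have : CompleteSpace S := hS.completeSpace_coe
    have hR' := hR.restrict hinv
    refine ⟨S, inferInstance, inferInstance, inferInstance,
      (CovariantRepresentation.restrict hinv).σ, S.subtypeₗᵢ.toContinuousLinearMap ∘L
        ((CovariantRepresentation.poissonKernel hR').toContinuousLinearMap†),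
      (CovariantRepresentation.restrict hinv).isRep, isPartialIsometry_comp_adjoint _ _, ?_, ?_⟩
    · refine le_antisymm ?_ fun s hs => ?_
      · rintro _ ⟨z, rfl⟩
        exact Subtype.property _
      · exact ⟨CovariantRepresentation.poissonKernel hR' ⟨s, hs⟩, congrArg Subtype.val
          (adjoint_linearIsometry_apply (CovariantRepresentation.poissonKernel hR') ⟨s, hs⟩)⟩
    · intro n ζ
      rw [ContinuousLinearMap.comp_assoc,
        CovariantRepresentation.adjoint_poissonKernel_comp_creationTensor]
      rfl
  · rintro ⟨D, _, _, _, π, W, -, -, rfl, hW⟩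
    have key : ∀ n ζ, ∀ s ∈ LinearMap.range W.toLinearMap,
        R.T n ζ s ∈ LinearMap.range W.toLinearMap := by
      rintro n ζ _ ⟨z, rfl⟩
      exact ⟨X.creationTensor π n ζ z, congrArg (fun A => A z) (hW n ζ)⟩
    refine ⟨fun a s hs => ?_, fun n _ => key n⟩
    rw [← R.T_unit]
    exact key 0 _ s hs

end
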